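/- **Setting.** A roommate instance $T$ consists of a finite set $A$ of agents, a symmetric irreflexive set of acceptable pairs (the edges of $T$), and, for every agent $z$, a strict linear order $>_z$ on the agents that form an edge with $z$ (the list of $z$). A subtable $T'\subseteq T$ is obtained by deleting edges; for subtables $T_1,T_2$ of $T$, $T_1\cup T_2$ is the subtable whose edges are those of $T_1$ or $T_2$. We write $f_{T}(z),s_{T}(z),\ell_{T}(z)$ for the first, second and last agent on the list of $z$ in $T$. A matching of $T$ is a set of pairwise disjoint edges of $T$; $\mathcal M(T)$ is the set of all of them. An edge $ab$ of $T$ blocks $M\in\mathcal M(T)$ if $a$ and $b$ each prefer the other to their situation in $M$ (being unmatched is worst), and a matching $M'$ blocks $M$ if an edge of $M'$ does. $\mathcal S(T)$ is the set of stable matchings, i.e. those blocked by no edge of $T$; $T$ is solvable if $\mathcal S(T)\ne\emptyset$. $E_S(T)$ is the subtable of $T$ whose edges are those contained in some stable matching of $T$. A set $\mathcal M'\subseteq\mathcal M(T)$ is internally stable if no member of it blocks a member of it; an internally stable $\mathcal M'$ is internally closed if every $M\in\mathcal M(T)$ for which $\{M\}\cup\mathcal M'$ is internally stable belongs to $\mathcal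 M'$. **Rotations.** A subtable $T'$ of $T$ is a *valid subtable* of $T$ if (a) every agent with a nonempty list in $T$ has a nonempty list in $T'$; (b) $w=f_{T'}(z)$ if and only if $z=\ell_{T'}(w)$; (c) for every edge $zw$ of $T$, $zw\notin T'$ if and only if $\ell_{T'}(z)>_z w$ or $\ell_{T'}(w)>_w z$. A rotation exposed in a valid subtable $T'$ of $T$ is a sequence $\rho=(x_0,y_0),\dots,(x_{r-1},y_{r-1})$ with $r\ge 1$, $y_i=f_{T'}(x_i)$ and $y_{i+1}=s_{T'}(x_i)$ for all $i$, indices modulo $r$; $\mathcal Z(T)$ is the set of all rotations exposed in some valid subtable of $T$. A rotation $\rho\in\mathcal Z(T)$ is non-singular in $T$ if its dual $\overline\rho=(y_1,x_0),(y_2,x_1),\dots,(y_0,x_{r-1})$ is in $\mathcal Z(T)$ too. We also regard $\rho$ as the set of edges $x_iy_i$. **Stitched rotations.** Let $T^*=E_S(T)$. An edge $xy$ of $T$ that is not in $T^*$ is antipodal with respect to $T^*$ if exactly one of the following holds: $y>_x f_{T^*}(x)$ and $\ell_{T^*}(y)>_y x$; or $x>_y f_{T^*}(y)$ and $\ell_{T^*}(x)>_x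 y$ (the lists involved being nonempty in $T^*$). A sequence $\rho$ as above is a *stitched rotation* with respect to $T^*$ if all $x_iy_i$ are edges of $T$ outside $T^*$ that are antipodal with respect to $T^*$, $\rho$ is a rotation exposed in the valid table $T^*\cup\rho$, and $\rho$ is non-singular in $T^*\cup\rho$. **Theorem.** Let $T$ be a solvable roommate instance and $T^*=E_S(T)$. 1. There is a matching $M\in\mathcal M(T)\setminus\mathcal S(T^*)$ that is not blocked by any edge of $T^*$ if and only if there is a stitched rotation with respect to $T^*$. 2. Every stitched rotation $\rho$ with respect to $T^*$ is contained in a matching $M\in\mathcal M(T)$ with $M\notin\mathcal S(T)$ and $M\notin\mathcal S(T^*)$ that is not blocked by any edge of $T^*$ and for which $\{M\}\cup\mathcal S(T^*)$ is internally stable. 3. $\mathcal S(T^*)$ is internally closed if and only if there is no stitched rotation with respect to $T^*$. -/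

import Mathlib

/-- A roommate instance on the set of agents `A`: the edges (mutually acceptable pairs) form the
simple graph `graph`, and `prefers z` is a strict linear order on the neighbours of `z`, where
`prefers z a b` says that `z` strictly prefers `a` to `b`.
Only the values of `prefers z` on neighbours of `z` carry information. -/
structure RoommateInstance (A : Type*) where
  graph : SimpleGraph A
  prefers : A → A → A → Prop
  prefers_irrefl : ∀ z a, graph.Adj z a → ¬ prefers z a a
  prefers_trans : ∀ z a b c, graph.Adj z a → graph.Adj z b → graph.Adj z c →
    prefers z a b → prefers z b c → prefers z a c
  prefers_total : ∀ z a b, graph.Adj z a → graph.Adj z b → a ≠ b →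
    prefers z a b ∨ prefers z b a

namespace RoommateInstance

variable {A : Type*}

/-- The subtable of `T` obtained by deleting all edges that are not in `G`. -/
def restrict (T : RoommateInstance A) (G : SimpleGraph A) : RoommateInstance A where
  graph := T.graph ⊓ G
  prefers := T.prefers
  prefers_irrefl z a h := T.prefers_irrefl z a h.1
  prefers_trans z a b c ha hb hc := T.prefers_trans z a b c ha.1 hb.1 hc.1
  prefers_total z a b ha hb := T.prefers_total z a b ha.1 hb.1

/-- `T'` is a subtable of `T`: every edge of `T'` is an edge of `T`, and the preference lists are
consistent. -/
def IsSubtable (T' T : RoommateInstance A) : Prop :=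
  T'.graph ≤ T.graph ∧
    ∀ z a b, T'.graph.Adj z a → T'.graph.Adj z b → (T'.prefers z a b ↔ T.prefers z a b)

/-! ### Matchings and stability -/

/-- The matchings of `T`, each given by the graph of its edges. -/
def matchings (T : RoommateInstance A) : Set (SimpleGraph A) :=
  {M | M ≤ T.graph ∧ ∀ a b c, M.Adj a b → M.Adj a c → b = c}

/-- `a` strictly prefers `b` to its situation in `M`; every acceptable agent is preferred to being
unmatched. -/
def PrefersToPartner (T : RoommateInstance A) (a b : A) (M : SimpleGraph A) : Prop :=
  ∀ c, M.Adj a c → T.prefers a b c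

/-- The pair `ab` is an edge of `T` that blocks the matching `M`. -/
def EdgeBlocks (T : RoommateInstance A) (a b : A) (M : SimpleGraph A) : Prop :=
  T.graph.Adj a b ∧ T.PrefersToPartner a b M ∧ T.PrefersToPartner b a M

/-- The matching `M'` blocks the matching `M`: some edge of `M'` blocks `M`. -/
def MatchingBlocks (T : RoommateInstance A) (M' M : SimpleGraph A) : Prop :=
  ∃ a b, M'.Adj a b ∧ T.EdgeBlocks a b M

/-- The set `S(T)` of stable matchings of `T`. -/
def stableMatchings (T : RoommateInstance A) : Set (SimpleGraph A) :=
  {M | M ∈ T.matchings ∧ ∀ a b, ¬ T.EdgeBlocks a b M}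

/-- `T` has a stable matching. -/
def Solvable (T : RoommateInstance A) : Prop := T.stableMatchings.Nonempty

/-- The graph of the stable edges of `T`. -/
def stableEdges (T : RoommateInstance A) : SimpleGraph A where
  Adj a b := ∃ M ∈ T.stableMatchings, M.Adj a b
  symm := ⟨fun _ _ ⟨M, hM, h⟩ => ⟨M, hM, h.symm⟩⟩
  loopless := ⟨fun _ ⟨_, _, h⟩ => h.ne rfl⟩

/-- The stable subtable `E_S(T)`, obtained from `T` by deleting all edges that are not stable. -/
def stableSubtable (T : RoommateInstance A) : RoommateInstance A :=
  T.restrict T.stableEdges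

/-- A set of matchings of `T` is internally stable if none of its members blocks another. -/
def InternallyStable (T : RoommateInstance A) (𝓜 : Set (SimpleGraph A)) : Prop :=
  𝓜 ⊆ T.matchings ∧ ∀ M₀ ∈ 𝓜, ∀ M₁ ∈ 𝓜, ¬ T.MatchingBlocks M₀ M₁

/-- The closure of a set of matchings of `T`: all matchings of `T` that can be added to it
individually so as to give an internally stable set. -/
def internalClosure (T : RoommateInstance A) (𝓜 : Set (SimpleGraph A)) : Set (SimpleGraph A) :=
  {M | M ∈ T.matchings ∧ T.InternallyStable ({M} ∪ 𝓜)}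

/-- An internally stable set of matchings of `T` is internally closed if it equals its closure. -/
def InternallyClosed (T : RoommateInstance A) (𝓜 : Set (SimpleGraph A)) : Prop :=
  T.InternallyStable 𝓜 ∧ T.internalClosure 𝓜 = 𝓜

/-! ### Valid tables and rotations -/

/-- `w` is the first agent on the list of `z` in `T`. -/
def IsFirst (T : RoommateInstance A) (z w : A) : Prop :=
  T.graph.Adj z w ∧ ∀ u, T.graph.Adj z u → u ≠ w → T.prefers z w u

/-- `w` is the second agent on the list of `z` in `T`. -/
def IsSecond (T : RoommateInstance A) (z w : A) : Prop :=
  T.graph.Adj z w ∧ ∃ v, T.IsFirst z v ∧ v ≠ w ∧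
    ∀ u, T.graph.Adj z u → u ≠ v → u ≠ w → T.prefers z w u

/-- `w` is the last agent on the list of `z` in `T`. -/
def IsLast (T : RoommateInstance A) (z w : A) : Prop :=
  T.graph.Adj z w ∧ ∀ u, T.graph.Adj z u → u ≠ w → T.prefers z u w

/-- `T'` is a valid subtable of `T`. The agents of a table are those whose list is nonempty
(agents with an empty row are regarded as removed), so the first condition says that no agent of
`T` has an empty list in `T'`. -/
structure IsValidSubtable (T' T : RoommateInstance A) : Prop where
  isSubtable : T'.IsSubtable T
  nonempty : ∀ z, (∃ w, T.graph.Adj z w) → ∃ w, T'.graph.Adj z w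
  first_iff_last : ∀ z w, T'.IsFirst z w ↔ T'.IsLast w z
  not_adj_iff : ∀ z w, T.graph.Adj z w →
    (¬ T'.graph.Adj z w ↔
      (∃ l, T'.IsLast z l ∧ T.prefers z l w) ∨ (∃ l, T'.IsLast w l ∧ T.prefers w l z))

end RoommateInstance

/-- A nonempty sequence `(x 0, y 0), …, (x (r - 1), y (r - 1))` of ordered pairs of agents. The
indices live in `Fin r`, where addition is modulo `r`. -/
structure PairSequence (A : Type*) where
  r : ℕ
  r_ne_zero : NeZero r
  x : Fin r → A
  y : Fin r → A

attribute [instance] PairSequence.r_ne_zero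

namespace PairSequence

variable {A : Type*}

/-- The dual sequence `(y 1, x 0), (y 2, x 1), …, (y 0, x (r - 1))`. -/
def dual (ρ : PairSequence A) : PairSequence A where
  r := ρ.r
  r_ne_zero := ρ.r_ne_zero
  x i := ρ.y (i + 1)
  y i := ρ.x i

/-- The graph whose edges are the pairs `x i y i` of the sequence. -/
def graph (ρ : PairSequence A) : SimpleGraph A :=
  SimpleGraph.fromRel fun a b => ∃ i, ρ.x i = a ∧ ρ.y i = b

end PairSequence

namespace RoommateInstance

variable {A : Type*}

/-- `ρ` is a rotation exposed in the valid subtable `T'` of `T`. -/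
def IsExposedRotation (T T' : RoommateInstance A) (ρ : PairSequence A) : Prop :=
  T'.IsValidSubtable T ∧ ∀ i, T'.IsFirst (ρ.x i) (ρ.y i) ∧ T'.IsSecond (ρ.x i) (ρ.y (i + 1))

/-- The set `Z(T)` of all rotations exposed in some valid subtable of `T`. -/
def rotations (T : RoommateInstance A) : Set (PairSequence A) :=
  {ρ | ∃ T' : RoommateInstance A, T.IsExposedRotation T' ρ}

/-- The set of non-singular rotations of `T`: those whose dual is a rotation of `T` as well. -/
def nonsingularRotations (T : RoommateInstance A) : Set (PairSequence A) :=
  {ρ | ρ ∈ T.rotations ∧ ρ.dual ∈ T.rotations}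

/-- The edge `xy` of `T` that is not an edge of `T'` satisfies the antipodal condition with respect
to `T'`: one endpoint prefers the other to the first agent on its list in `T'`, whereas the other
one prefers the last agent on its own list in `T'`. -/
def IsAntipodal (T T' : RoommateInstance A) (x y : A) : Prop :=
  T.graph.Adj x y ∧ ¬ T'.graph.Adj x y ∧
    Xor ((∃ f, T'.IsFirst x f ∧ T.prefers x y f) ∧ (∃ l, T'.IsLast y l ∧ T.prefers y l x))
      ((∃ f, T'.IsFirst y f ∧ T.prefers y x f) ∧ (∃ l, T'.IsLast x l ∧ T.prefers x l y))

/-- The subtable `T' ∪ ρ` of `T`, for a subtable `T'` of `T` and a sequence `ρ` of edges of `T`. -/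
def union (T T' : RoommateInstance A) (ρ : PairSequence A) : RoommateInstance A :=
  T.restrict (T'.graph ⊔ ρ.graph)

/-- `ρ` is a stitched rotation with respect to the stable subtable `T* = E_S(T)`. -/
def IsStitchedRotation (T : RoommateInstance A) (ρ : PairSequence A) : Prop :=
  (∀ i, T.IsAntipodal T.stableSubtable (ρ.x i) (ρ.y i)) ∧
    (T.union T.stableSubtable ρ).IsExposedRotation (T.union T.stableSubtable ρ) ρ ∧
    ρ ∈ (T.union T.stableSubtable ρ).nonsingularRotations

end RoommateInstance

/-! The tool is the bipartite double cover. A permutation `f` of the agents, stable in the sense of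
`IsStablePerm`, is a stable matching of that cover; inversion swaps the two sides, and stable
matchings of the roommate instance are exactly the stable involutions. So the lattice operations of
stable marriage become available (`exists_sup`, `exists_inf`), and if `f.symm` lies below `f`, the
median of `f.symm`, `p`, `f` with a stable involution `p` is again a stable involution
(`exists_median`).

If `T` is solvable, there is a stable permutation `F` that gives each agent its best stable partner,
and `F.symm` gives the worst. Every edge of a stable permutation between these bounds is a stable
edge (`IsBestStablePerm.stableSubtable_adj`). Hence `F` and `F.symm` are the first and last agents
of `T*`, and rotations in `T* ∪ ρ` can be described by permutations.

From a matching to a rotation: let `p` be the involution of a matching outside `S(T*)` that no edge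
of `T*` blocks. It is stable for the edges of `T*` together with its own, as is `F`. An edge of `p`
outside `T*` cannot lie strictly between worst and best (`stableSubtable_adj_of_lt`), so it puts one
endpoint above its best stable partner and the other below its worst. Such endpoints are alternately
linked by `p` and `F`, and a closed alternating walk is a stitched rotation. The median of `F.symm`,
`p`, `F` supplies a matching in `T*` that together with the rotation forms the table exposing the
dual.

From a rotation to a matching: the stable matchings of `T` remain stable in `T* ∪ ρ`, so
`exists_isStablePerm_apply_eq` yields a stable matching of `T* ∪ ρ` containing `ρ`. Antipodality
prevents the edges of `ρ` from blocking any member of `S(T*)`. The closedness criterion follows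
because every edge of `T*` occurs in a member of `S(T*)`. -/

namespace RoommateInstance

variable {A : Type*}

/-! ### Preferences as utilities -/

section Utility

open Classical in
/-- A numerical representation of the preferences: acceptable agents have positive utility, all
other agents have utility zero. -/
noncomputable def util (T : RoommateInstance A) (z w : A) : ℕ :=
  if T.graph.Adj z w then {v | T.graph.Adj z v ∧ T.prefers z w v}.ncard + 1 else 0

theorem util_pos_iff (T : RoommateInstance A) {z w : A} :
    0 < T.util z w ↔ T.graph.Adj z w := by
  unfold util
  split_ifs with h <;> simp [h]

theorem util_self (T : RoommateInstance A) (z : A) : T.util z z = 0 := by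
  simp [util]

variable [Finite A]

theorem util_lt_of_prefers (T : RoommateInstance A) {z a b : A} (ha : T.graph.Adj z a)
    (hb : T.graph.Adj z b) (h : T.prefers z a b) : T.util z b < T.util z a := by
  unfold util
  rw [if_pos ha, if_pos hb]
  refine Nat.succ_lt_succ (Set.ncard_lt_ncard ?_ (Set.toFinite _))
  refine ⟨fun v hv => ⟨hv.1, T.prefers_trans z a b v ha hb hv.1 h hv.2⟩, fun hs => ?_⟩
  exact T.prefers_irrefl z b hb (hs (show T.graph.Adj z b ∧ T.prefers z a b from ⟨hb, h⟩)).2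

theorem util_lt_iff (T : RoommateInstance A) {z a b : A} (ha : T.graph.Adj z a)
    (hb : T.graph.Adj z b) : T.util z b < T.util z a ↔ T.prefers z a b := by
  refine ⟨fun h => ?_, T.util_lt_of_prefers ha hb⟩
  by_contra hn
  by_cases hab : a = b
  · subst hab; omega
  · have := T.util_lt_of_prefers hb ha ((T.prefers_total z a b ha hb hab).resolve_left hn)
    omega

theorem util_inj (T : RoommateInstance A) {z a b : A} (ha : T.graph.Adj z a)
    (h : T.util z a = T.util z b) : a = b := by
  have hb : T.graph.Adj z b := T.util_pos_iff.1 (h ▸ T.util_pos_iff.2 ha)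
  by_contra hab
  rcases T.prefers_total z a b ha hb hab with h' | h'
  · have := T.util_lt_of_prefers ha hb h'; omega
  · have := T.util_lt_of_prefers hb ha h'; omega

end Utility

/-! ### The lattice of stable permutations -/

/-- A permutation `f` of the agents is stable with respect to a set `G` of edges of `T` if it is a
stable matching of the bipartite double cover of `G`: the agent `z` on the one side is matched to
the agent `f z` on the other side, and fixed points stand for unmatched agents. -/
structure IsStablePerm (T : RoommateInstance A) (G : SimpleGraph A) (f : Equiv.Perm A) :
    Prop where
  le : G ≤ T.graph
  adj : ∀ z, f z ≠ z → G.Adj z (f z)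
  stable : ∀ z w, G.Adj z w →
    T.util z w ≤ T.util z (f z) ∨ T.util w z ≤ T.util w (f.symm w)

namespace IsStablePerm

variable {T : RoommateInstance A} {G : SimpleGraph A} {f g : Equiv.Perm A}

theorem adj_of_util_pos (hf : T.IsStablePerm G f) {z : A} (h : 0 < T.util z (f z)) :
    G.Adj z (f z) := by
  refine hf.adj z fun h' => ?_
  rw [h', T.util_self] at h
  exact h.false

theorem util_pos (hf : T.IsStablePerm G f) {z : A} (h : f z ≠ z) : 0 < T.util z (f z) :=
  T.util_pos_iff.2 (hf.le (hf.adj z h))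

theorem inv (hf : T.IsStablePerm G f) : T.IsStablePerm G f.symm where
  le := hf.le
  adj z h := by
    have := hf.adj (f.symm z) (by simpa using fun h' => h h'.symm)
    simpa using this.symm
  stable z w h := by simpa [or_comm] using hf.stable w z h.symm

theorem mono (hf : T.IsStablePerm G f) {G' : SimpleGraph A} (hG : G' ≤ G)
    (h : ∀ z, f z ≠ z → G'.Adj z (f z)) : T.IsStablePerm G' f :=
  ⟨hG.trans hf.le, h, fun z w hzw => hf.stable z w (hG hzw)⟩

variable [Finite A]

theorem eq_of_util_eq (hf : T.IsStablePerm G f) {z w : A} (hw : w ≠ z → T.graph.Adj z w)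
    (h : T.util z (f z) = T.util z w) : f z = w := by
  by_cases hz : f z = z
  · by_contra hne
    rw [hz] at h hne
    have := T.util_pos_iff.2 (hw (Ne.symm hne))
    rw [T.util_self] at h
    omega
  · exact T.util_inj (hf.le (hf.adj z hz)) h

/-- If `z` is strictly better off in `g` than in `f`, then the partner of `z` in `g` is strictly
better off in `f`. -/
theorem util_symm_lt (hf : T.IsStablePerm G f) (hg : T.IsStablePerm G g) {z : A}
    (h : T.util z (f z) < T.util z (g z)) :
    T.util (g z) (g.symm (g z)) < T.util (g z) (f.symm (g z)) := by
  have hadj := hg.adj_of_util_pos (Nat.zero_lt_of_lt h)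
  have h1 := (hf.stable z (g z) hadj).resolve_left (by omega)
  rw [Equiv.symm_apply_apply]
  refine lt_of_le_of_ne h1 fun h2 => ?_
  have h3 := T.util_inj (hg.le hadj.symm) h2
  have h4 : f z = g z := by
    conv_lhs => rw [h3]
    simp
  rw [h4] at h
  exact h.false

/-- If `z` is strictly better off in `g` than in `f`, then the partner of `z` in `f` is strictly
better off in `f`. -/
theorem util_symm_lt' (hf : T.IsStablePerm G f) (hg : T.IsStablePerm G g) {z : A}
    (h : T.util z (f z) < T.util z (g z)) :
    T.util (f z) (g.symm (f z)) < T.util (f z) (f.symm (f z)) := by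
  -- Counting: `g` injects `P` into `Q` and `f.symm` injects `Q` into `P`. By finiteness `f.symm ''
  -- Q = P`.
  set P : Set A := {z | T.util z (f z) < T.util z (g z)} with hP
  set Q : Set A := {w | T.util w (g.symm w) < T.util w (f.symm w)} with hQ
  have h1 : g '' P ⊆ Q := by
    rintro _ ⟨z, hz, rfl⟩
    exact hf.util_symm_lt hg hz
  have h2 : f.symm '' Q ⊆ P := by
    rintro _ ⟨w, hw, rfl⟩
    have := hg.inv.util_symm_lt hf.inv (z := w) hw
    simpa [hP] using this
  have h3 : P.ncard ≤ (f.symm '' Q).ncard := by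
    rw [Set.ncard_image_of_injective _ f.symm.injective,
      ← Set.ncard_image_of_injective P g.injective]
    exact Set.ncard_le_ncard h1 (Set.toFinite _)
  have h4 := Set.eq_of_subset_of_ncard_le h2 h3 (Set.toFinite _)
  have h5 : z ∈ f.symm '' Q := h4 ▸ h
  obtain ⟨w, hw, rfl⟩ := h5
  simpa [hQ] using hw

/-- All stable permutations match the same agents. -/
theorem ne_self_of_ne_self (hf : T.IsStablePerm G f) (hg : T.IsStablePerm G g) {z : A}
    (h : g z ≠ z) : f z ≠ z := by
  intro h'
  have h1 : T.util z (f z) < T.util z (g z) := by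
    rw [h', T.util_self]; exact hg.util_pos h
  have h2 := hf.util_symm_lt' hg h1
  rw [Equiv.symm_apply_apply, h', T.util_self] at h2
  omega

theorem util_symm_le_of_util_le (hf : T.IsStablePerm G f) (hg : T.IsStablePerm G g)
    (h : ∀ z, T.util z (f z) ≤ T.util z (g z)) (w : A) :
    T.util w (g.symm w) ≤ T.util w (f.symm w) := by
  by_contra hlt
  have := hf.inv.util_symm_lt hg.inv (not_le.1 hlt)
  have h2 := h (g.symm w)
  simp only [Equiv.symm_symm] at this
  omega

/-- Each agent takes the better of its two values. No two choices collide: an agent gaining from `g`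
has an image that prefers `f`, whereas the `f`-image of any other agent does not. -/
theorem exists_sup (hf : T.IsStablePerm G f) (hg : T.IsStablePerm G g) :
    ∃ k, T.IsStablePerm G k ∧ (∀ z, k z = f z ∨ k z = g z) ∧
      (∀ z, T.util z (k z) = max (T.util z (f z)) (T.util z (g z))) ∧
      ∀ z, T.util z (k.symm z) = min (T.util z (f.symm z)) (T.util z (g.symm z)) := by
  classical
  let k₀ : A → A := fun z => if T.util z (f z) < T.util z (g z) then g z else f z
  have hpos : ∀ z, T.util z (f z) < T.util z (g z) → k₀ z = g z := fun z h => if_pos h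
  have hneg : ∀ z, ¬ T.util z (f z) < T.util z (g z) → k₀ z = f z := fun z h => if_neg h
  have hQ : ∀ z, ¬ T.util z (f z) < T.util z (g z) →
      ¬ T.util (f z) (g.symm (f z)) < T.util (f z) (f.symm (f z)) := by
    intro z hz h
    have := hg.inv.util_symm_lt hf.inv (z := f z) (by simpa using h)
    simp at this
    omega
  have hinj : Function.Injective k₀ := by
    intro z z' h
    by_cases hz : T.util z (f z) < T.util z (g z) <;>
      by_cases hz' : T.util z' (f z') < T.util z' (g z')
    · rw [hpos z hz, hpos z' hz'] at h
      exact g.injective h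
    · rw [hpos z hz, hneg z' hz'] at h
      have := hf.util_symm_lt hg hz
      rw [h] at this
      exact absurd this (hQ z' hz')
    · rw [hneg z hz, hpos z' hz'] at h
      have := hf.util_symm_lt hg hz'
      rw [← h] at this
      exact absurd this (hQ z hz)
    · rw [hneg z hz, hneg z' hz'] at h
      exact f.injective h
  let k : Equiv.Perm A := Equiv.ofBijective k₀ (Finite.injective_iff_bijective.1 hinj)
  have hk : ∀ z, k z = k₀ z := fun _ => rfl
  have hmax : ∀ z, T.util z (k z) = max (T.util z (f z)) (T.util z (g z)) := by
    intro z
    rw [hk]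
    by_cases hz : T.util z (f z) < T.util z (g z)
    · rw [hpos z hz]; omega
    · rw [hneg z hz]; omega
  have hmin : ∀ z, T.util z (k.symm z) = min (T.util z (f.symm z)) (T.util z (g.symm z)) := by
    intro w
    obtain ⟨z, rfl⟩ := k.surjective w
    rw [Equiv.symm_apply_apply, hk]
    by_cases hz : T.util z (f z) < T.util z (g z)
    · have := hf.util_symm_lt hg hz
      rw [hpos z hz]
      rw [Equiv.symm_apply_apply] at this ⊢
      omega
    · have := hQ z hz
      rw [hneg z hz]
      rw [Equiv.symm_apply_apply] at this ⊢
      omega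
  have hor : ∀ z, k z = f z ∨ k z = g z := fun z => by
    rw [hk]
    by_cases hz : T.util z (f z) < T.util z (g z)
    · exact Or.inr (hpos z hz)
    · exact Or.inl (hneg z hz)
  refine ⟨k, ⟨hf.le, fun z hz => ?_, fun z w hzw => ?_⟩, hor, hmax, hmin⟩
  · rcases hor z with h | h <;> rw [h] at hz ⊢
    · exact hf.adj z hz
    · exact hg.adj z hz
  · have h1 := hf.stable z w hzw
    have h2 := hg.stable z w hzw
    rw [hmax, hmin]
    omega

theorem exists_inf (hf : T.IsStablePerm G f) (hg : T.IsStablePerm G g) :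
    ∃ k, T.IsStablePerm G k ∧
      (∀ z, T.util z (k z) = min (T.util z (f z)) (T.util z (g z))) ∧
      ∀ z, T.util z (k.symm z) = max (T.util z (f.symm z)) (T.util z (g.symm z)) := by
  obtain ⟨k, hk, -, h1, h2⟩ := hf.inv.exists_sup hg.inv
  exact ⟨k.symm, hk.inv, by simpa using h2, by simpa using h1⟩

/-- The median of a stable permutation, its inverse, and a stable involution is a stable
involution. -/
theorem exists_median (hf : T.IsStablePerm G f) (hle : ∀ z, T.util z (f.symm z) ≤ T.util z (f z))
    {p : Equiv.Perm A} (hp : T.IsStablePerm G p) (hsymm : p.symm = p) :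
    ∃ m, T.IsStablePerm G m ∧ m.symm = m ∧
      ∀ z, T.util z (m z) = max (T.util z (f.symm z)) (min (T.util z (p z)) (T.util z (f z))) := by
  obtain ⟨k, hk, hk1, hk2⟩ := hp.exists_inf hf
  obtain ⟨m, hm, -, hm1, hm2⟩ := hf.inv.exists_sup hk
  refine ⟨m, hm, ?_, fun z => by rw [hm1, hk1]⟩
  -- The inverse of `m` has utility `min f (max p f.symm)`, which equals `max f.symm (min p f)`
  -- because `f.symm` lies below `f`.
  ext z
  refine hm.inv.eq_of_util_eq (fun h => hm.le (hm.adj z h)) ?_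
  rw [hm1, hm2, hk1, hk2, hsymm, Equiv.symm_symm]
  have := hle z
  omega

end IsStablePerm

end RoommateInstance

/-! ### Descending one step in the lattice -/

namespace RoommateInstance

variable {A : Type*}

namespace IsStablePerm

variable {T : RoommateInstance A} {G : SimpleGraph A} {f g : Equiv.Perm A} [Finite A]

/-- Between two comparable stable permutations there is one that is obtained from the larger one by
moving some agents to the next agent on their list who accepts them. -/
theorem exists_lt (hg : T.IsStablePerm G g) (hf : T.IsStablePerm G f)
    (hle : ∀ z, T.util z (f z) ≤ T.util z (g z)) (hne : f ≠ g) :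
    ∃ h, T.IsStablePerm G h ∧ (∀ z, T.util z (f z) ≤ T.util z (h z)) ∧
      (∀ z, T.util z (h z) ≤ T.util z (g z)) ∧ (∃ z, T.util z (h z) < T.util z (g z)) ∧
      ∀ z, h z ≠ g z → ∀ w, G.Adj z w → T.util z w < T.util z (g z) →
        T.util w (g.symm w) < T.util w z → T.util z w ≤ T.util z (h z) := by
  classical
  -- Candidates for a move down: agents below `g z` that would gain by receiving `z`. The best of
  -- them will be `s z`.
  let C : A → Set A := fun z =>
    {w | G.Adj z w ∧ T.util z w < T.util z (g z) ∧ T.util w (g.symm w) < T.util w z}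
  have hlt : ∀ z, f z ≠ g z → T.util z (f z) < T.util z (g z) := fun z hz =>
    lt_of_le_of_ne (hle z) fun h => hz (hf.eq_of_util_eq (fun h' => hg.le (hg.adj z h')) h)
  have hmem : ∀ z, f z ≠ g z → f z ∈ C z := by
    intro z hz
    have h1 := hf.util_symm_lt' hg (hlt z hz)
    rw [Equiv.symm_apply_apply] at h1
    have h2 : f z ≠ z := fun h => by
      rw [h, T.util_self] at h1
      omega
    exact ⟨hf.adj z h2, hlt z hz, h1⟩
  have hex : ∀ z, ∃ w, f z ≠ g z → w ∈ C z ∧ ∀ v ∈ C z, T.util z v ≤ T.util z w := by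
    intro z
    by_cases hz : f z ≠ g z
    · obtain ⟨w, hw, hmax⟩ := Set.exists_max_image (C z) (T.util z) (Set.toFinite _) ⟨_, hmem z hz⟩
      exact ⟨w, fun _ => ⟨hw, hmax⟩⟩
    · exact ⟨z, fun h => absurd h hz⟩
  choose s hs using hex
  -- The agent that loses its `g`-partner when `z` moves to `s z`.
  let nx : A → A := fun z => g.symm (s z)
  -- If `f` and `g` agreed at `nx z`, then `s z` would have the same partner in both and prefer `z`
  -- to it. Stability of `f` would force `f z = s z`, contradicting that strict preference.
  have hnx : ∀ z, f z ≠ g z → f (nx z) ≠ g (nx z) := by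
    intro z hz h
    obtain ⟨⟨h1, h2, h3⟩, h4⟩ := hs z hz
    have h5 : f.symm (s z) = g.symm (s z) := by
      rw [Equiv.symm_apply_eq, show g.symm (s z) = nx z from rfl, h]
      simp [nx]
    have h6 := h4 _ (hmem z hz)
    rcases hf.stable z (s z) h1 with h7 | h7
    · have h8 : f z = s z := T.util_inj (hf.le (hmem z hz).1) (le_antisymm h6 h7)
      rw [← h5, ← h8, Equiv.symm_apply_apply] at h3
      exact h3.false
    · rw [h5] at h7
      omega
  let P : Set A := {z | f z ≠ g z ∧ z ∈ Function.periodicPts nx}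
  have hnxP : ∀ z ∈ P, nx z ∈ P := fun z hz =>
    ⟨hnx z hz.1, (Function.bijOn_periodicPts nx).mapsTo hz.2⟩
  have hPne : P.Nonempty := by
    obtain ⟨z, hz⟩ : ∃ z, f z ≠ g z := by
      by_contra! h
      exact hne (Equiv.ext h)
    have hit : ∀ n, f (nx^[n] z) ≠ g (nx^[n] z) := by
      intro n
      induction n with
      | zero => exact hz
      | succ n ih => rw [Function.iterate_succ_apply']; exact hnx _ ih
    obtain ⟨m, n, hmn, h⟩ := Finite.exists_ne_map_eq_of_infinite fun n : ℕ => nx^[n] z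
    wlog hlt' : m < n generalizing m n
    · exact this n m hmn.symm h.symm (by omega)
    refine ⟨nx^[m] z, hit m, Function.mk_mem_periodicPts (n := n - m) (by omega) ?_⟩
    rw [Function.IsPeriodicPt, Function.IsFixedPt, ← Function.iterate_add_apply,
      Nat.sub_add_cancel hlt'.le]
    exact h.symm
  let h₀ : A → A := fun z => if z ∈ P then s z else g z
  have hpos : ∀ z, z ∈ P → h₀ z = s z := fun z hz => if_pos hz
  have hneg : ∀ z, z ∉ P → h₀ z = g z := fun z hz => if_neg hz
  have hinj : Function.Injective h₀ := by
    intro z z' h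
    by_cases hz : z ∈ P <;> by_cases hz' : z' ∈ P
    · rw [hpos z hz, hpos z' hz'] at h
      exact (Function.bijOn_periodicPts nx).injOn hz.2 hz'.2 (congrArg g.symm h)
    · rw [hpos z hz, hneg z' hz'] at h
      have h1 := hnxP z hz
      rw [show nx z = g.symm (s z) from rfl, h, Equiv.symm_apply_apply] at h1
      exact absurd h1 hz'
    · rw [hneg z hz, hpos z' hz'] at h
      have h1 := hnxP z' hz'
      rw [show nx z' = g.symm (s z') from rfl, ← h, Equiv.symm_apply_apply] at h1
      exact absurd h1 hz
    · rw [hneg z hz, hneg z' hz'] at h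
      exact g.injective h
  let h : Equiv.Perm A := Equiv.ofBijective h₀ (Finite.injective_iff_bijective.1 hinj)
  have hh : ∀ z, h z = h₀ z := fun _ => rfl
  have hsymm : ∀ w, T.util w (g.symm w) ≤ T.util w (h.symm w) := by
    intro w
    obtain ⟨z, rfl⟩ := h.surjective w
    rw [Equiv.symm_apply_apply, hh]
    by_cases hz : z ∈ P
    · rw [hpos z hz]
      exact (hs z hz.1).1.2.2.le
    · rw [hneg z hz, Equiv.symm_apply_apply]
  have hltP : ∀ z ∈ P, T.util z (h z) < T.util z (g z) := fun z hz => by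
    rw [hh, hpos z hz]
    exact (hs z hz.1).1.2.1
  refine ⟨h, ⟨hg.le, fun z hz => ?_, fun z w hzw => ?_⟩, fun z => ?_, fun z => ?_,
    hPne.imp hltP, fun z hz w hzw hw1 hw2 => ?_⟩
  · rw [hh] at hz ⊢
    by_cases hzP : z ∈ P
    · rw [hpos z hzP]
      exact (hs z hzP.1).1.1
    · rw [hneg z hzP] at hz ⊢
      exact hg.adj z hz
  · by_contra! hb
    have h1 := hsymm w
    have h2 := (hg.stable z w hzw).resolve_right (by omega)
    by_cases hzP : z ∈ P
    · have h3 : T.util z w ≠ T.util z (g z) := fun h3 => by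
        rw [T.util_inj (hg.le hzw) h3, Equiv.symm_apply_apply] at h1
        rw [T.util_inj (hg.le hzw) h3] at hb
        omega
      have h4 := (hs z hzP.1).2 w ⟨hzw, by omega, by omega⟩
      rw [hh, hpos z hzP] at hb
      omega
    · rw [hh, hneg z hzP] at hb
      omega
  · by_cases hzP : z ∈ P
    · rw [hh, hpos z hzP]
      exact (hs z hzP.1).2 _ (hmem z hzP.1)
    · rw [hh, hneg z hzP]
      exact hle z
  · by_cases hzP : z ∈ P
    · exact (hltP z hzP).le
    · rw [hh, hneg z hzP]
  · have hzP : z ∈ P := by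
      by_contra hzP
      exact hz (by rw [hh, hneg z hzP])
    rw [hh, hpos z hzP]
    exact (hs z hzP.1).2 w ⟨hzw, hw1, hw2⟩

end IsStablePerm

/-! ### Matchings as involutions -/

/-- The involution `p` maps every agent to its partner in `M`, and fixes the unmatched agents. -/
def IsPartnerPerm (M : SimpleGraph A) (p : Equiv.Perm A) : Prop :=
  p.symm = p ∧ ∀ z w, M.Adj z w ↔ p z = w ∧ w ≠ z

theorem exists_isPartnerPerm {M : SimpleGraph A}
    (hM : ∀ a b c, M.Adj a b → M.Adj a c → b = c) : ∃ p, IsPartnerPerm M p := by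
  classical
  have hex : ∀ z, ∃ w, (M.Adj z w) ∨ (z = w ∧ ∀ v, ¬ M.Adj z v) := by
    intro z
    by_cases h : ∃ w, M.Adj z w
    · exact h.imp fun _ => Or.inl
    · exact ⟨z, Or.inr ⟨rfl, not_exists.1 h⟩⟩
  choose q hq using hex
  have hq' : ∀ z w, M.Adj z w → q z = w := by
    intro z w h
    rcases hq z with h' | h'
    · exact hM z _ _ h' h
    · exact absurd h (h'.2 w)
  have hinv : Function.Involutive q := by
    intro z
    rcases hq z with h | h
    · exact hq' _ _ h.symm
    · rw [← h.1, ← h.1]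
  refine ⟨hinv.toPerm q, Function.Involutive.toPerm_symm hinv,
    fun z w => ⟨fun h => ⟨hq' z w h, h.ne'⟩, ?_⟩⟩
  rintro ⟨h, hne⟩
  rcases hq z with h' | h'
  · rwa [show q z = w from h] at h'
  · exact absurd (h'.1.trans h).symm hne

theorem exists_graph_isPartnerPerm {p : Equiv.Perm A} (hp : p.symm = p) :
    ∃ M : SimpleGraph A, IsPartnerPerm M p := by
  refine ⟨SimpleGraph.fromRel fun a b => p a = b, hp, fun z w => ?_⟩
  have h : p w = z ↔ p z = w := by
    conv_lhs => rw [← hp, Equiv.symm_apply_eq]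
    exact eq_comm
  rw [SimpleGraph.fromRel_adj, h, or_self, and_comm, ne_comm]

theorem apply_apply_of_symm_eq {p : Equiv.Perm A} (hp : p.symm = p) (z : A) : p (p z) = z := by
  have := p.apply_symm_apply z
  rwa [hp] at this

namespace IsPartnerPerm

variable {T : RoommateInstance A} {M : SimpleGraph A} {p : Equiv.Perm A}

theorem eq_of_adj (h : IsPartnerPerm M p) {a b c : A} (hb : M.Adj a b) (hc : M.Adj a c) :
    b = c :=
  ((h.2 a b).1 hb).1.symm.trans ((h.2 a c).1 hc).1

theorem adj_apply (h : IsPartnerPerm M p) {z : A} (hz : p z ≠ z) : M.Adj z (p z) :=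
  (h.2 z (p z)).2 ⟨rfl, hz⟩

variable [Finite A]

theorem prefersToPartner_iff (h : IsPartnerPerm M p) (hM : M ≤ T.graph) {a b : A}
    (hab : T.graph.Adj a b) : T.PrefersToPartner a b M ↔ T.util a (p a) < T.util a b := by
  constructor
  · intro hb
    by_cases ha : p a = a
    · rw [ha, T.util_self]
      exact T.util_pos_iff.2 hab
    · exact (T.util_lt_iff hab (hM (h.adj_apply ha))).2 (hb _ (h.adj_apply ha))
  · intro hlt c hc
    rw [((h.2 a c).1 hc).1] at hlt
    exact (T.util_lt_iff hab (hM hc)).1 hlt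

theorem edgeBlocks_iff (h : IsPartnerPerm M p) (hM : M ≤ T.graph) {a b : A} :
    T.EdgeBlocks a b M ↔
      T.graph.Adj a b ∧ T.util a (p a) < T.util a b ∧ T.util b (p b) < T.util b a := by
  refine and_congr_right fun hab => ?_
  rw [h.prefersToPartner_iff hM hab, h.prefersToPartner_iff hM hab.symm]

/-- For an involution both sides of the double cover carry the same partners, so stability there is
ordinary stability. -/
theorem isStablePerm_iff (h : IsPartnerPerm M p) {G : SimpleGraph A} (hG : G ≤ T.graph) :
    T.IsStablePerm G p ↔ M ≤ G ∧ ∀ a b, G.Adj a b → ¬ T.EdgeBlocks a b M := by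
  constructor
  · intro hp
    have hM : M ≤ G := by
      intro a b hab
      obtain ⟨h1, h2⟩ := (h.2 a b).1 hab
      rw [← h1] at h2 ⊢
      exact hp.adj a h2
    refine ⟨hM, fun a b hab hb => ?_⟩
    rw [h.edgeBlocks_iff (hM.trans hG)] at hb
    have := hp.stable a b hab
    rw [h.1] at this
    omega
  · rintro ⟨hM, hb⟩
    refine ⟨hG, fun z hz => hM (h.adj_apply hz), fun z w hzw => ?_⟩
    have := hb z w hzw
    rw [h.edgeBlocks_iff (hM.trans hG)] at this
    rw [h.1]
    by_contra! hlt
    exact this ⟨hG hzw, hlt⟩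

/-- Lets every subtable be treated with the utilities of the ambient `T`; only the edge set varies.
-/
theorem mem_stableMatchings_iff (h : IsPartnerPerm M p) {T' : RoommateInstance A}
    (hT' : T'.graph ≤ T.graph) (hpref : T'.prefers = T.prefers) :
    M ∈ T'.stableMatchings ↔ T.IsStablePerm T'.graph p := by
  have hpp : ∀ a b, T'.PrefersToPartner a b M ↔ T.PrefersToPartner a b M := fun a b => by
    unfold PrefersToPartner
    rw [hpref]
  have hEB : ∀ a b, T'.EdgeBlocks a b M ↔ T'.graph.Adj a b ∧ T.EdgeBlocks a b M := by
    intro a b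
    unfold EdgeBlocks
    rw [hpp, hpp]
    exact ⟨fun hh => ⟨hh.1, hT' hh.1, hh.2⟩, fun hh => ⟨hh.1, hh.2.2⟩⟩
  rw [h.isStablePerm_iff hT']
  constructor
  · rintro ⟨⟨h1, -⟩, h2⟩
    exact ⟨h1, fun a b hab hb => h2 a b ((hEB a b).2 ⟨hab, hb⟩)⟩
  · rintro ⟨h1, h2⟩
    exact ⟨⟨h1, fun a b c => h.eq_of_adj⟩, fun a b hb =>
      h2 a b ((hEB a b).1 hb).1 ((hEB a b).1 hb).2⟩

end IsPartnerPerm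

/-! ### Best and worst stable partners -/

section StableSubtable

variable {T : RoommateInstance A}

theorem stableSubtable_graph_le : T.stableSubtable.graph ≤ T.graph := inf_le_left

/-- The stable permutation `F` maps every agent to its best stable partner. -/
structure IsBestStablePerm (T : RoommateInstance A) (F : Equiv.Perm A) : Prop where
  isStablePerm : T.IsStablePerm T.graph F
  attained : ∀ z, ∃ p, T.IsStablePerm T.graph p ∧ p.symm = p ∧ p z = F z
  util_le : ∀ p, T.IsStablePerm T.graph p → p.symm = p → ∀ z, T.util z (p z) ≤ T.util z (F z)

theorem IsBestStablePerm.attained_symm {F : Equiv.Perm A} (hF : T.IsBestStablePerm F) (z : A) :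
    ∃ p, T.IsStablePerm T.graph p ∧ p.symm = p ∧ p z = F.symm z := by
  obtain ⟨p, hp, hsymm, h⟩ := hF.attained (F.symm z)
  refine ⟨p, hp, hsymm, ?_⟩
  rw [Equiv.apply_symm_apply] at h
  rw [← apply_apply_of_symm_eq hsymm (F.symm z), h]

variable [Finite A]

theorem stableSubtable_adj_iff {a b : A} : T.stableSubtable.graph.Adj a b ↔
    b ≠ a ∧ ∃ p, T.IsStablePerm T.graph p ∧ p.symm = p ∧ p a = b := by
  constructor
  · rintro ⟨-, M, hM, hab⟩
    obtain ⟨p, hp⟩ := exists_isPartnerPerm hM.1.2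
    exact ⟨hab.ne', p, (hp.mem_stableMatchings_iff le_rfl rfl).1 hM, hp.1, ((hp.2 a b).1 hab).1⟩
  · rintro ⟨hne, p, hp, hsymm, rfl⟩
    obtain ⟨M, hM⟩ := exists_graph_isPartnerPerm hsymm
    exact ⟨hp.adj a hne, M, (hM.mem_stableMatchings_iff le_rfl rfl).2 hp, hM.adj_apply hne⟩

theorem exists_isStablePerm_of_solvable (hT : T.Solvable) :
    ∃ p, T.IsStablePerm T.graph p ∧ p.symm = p := by
  obtain ⟨M, hM⟩ := hT
  obtain ⟨p, hp⟩ := exists_isPartnerPerm hM.1.2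
  exact ⟨p, (hp.mem_stableMatchings_iff le_rfl rfl).1 hM, hp.1⟩

/-- Maximize total utility among the stable permutations all of whose values come from stable
involutions. Joining with a stable involution stays in this class, so a maximizer dominates all of
them. -/
theorem exists_isBestStablePerm (hT : T.Solvable) : ∃ F, T.IsBestStablePerm F := by
  obtain ⟨p, hp, hsymm⟩ := exists_isStablePerm_of_solvable hT
  cases nonempty_fintype A
  let K : Set (Equiv.Perm A) := {f | T.IsStablePerm T.graph f ∧
    ∀ z, ∃ p, T.IsStablePerm T.graph p ∧ p.symm = p ∧ p z = f z}
  obtain ⟨F, hF, hmax⟩ := Set.exists_max_image K (fun f => ∑ z, T.util z (f z)) (Set.toFinite _)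
    ⟨p, hp, fun z => ⟨p, hp, hsymm, rfl⟩⟩
  refine ⟨F, hF.1, hF.2, fun q hq hq' z => ?_⟩
  obtain ⟨k, hk, hor, hk1, -⟩ := hF.1.exists_sup hq
  have h := hmax k ⟨hk, fun z => (hor z).elim (fun h => h ▸ hF.2 z) fun h => ⟨q, hq, hq', h.symm⟩⟩
  by_contra hlt
  refine absurd h (not_le.2 (Finset.sum_lt_sum (fun i _ => ?_) ⟨z, Finset.mem_univ z, ?_⟩)) <;>
  · rw [hk1]; omega

namespace IsBestStablePerm

variable {F : Equiv.Perm A}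

/-- Inversion reverses the order of stable permutations and fixes involutions, so `F.symm` is a
lower bound as `F` is an upper one. -/
theorem symm_util_le (hF : T.IsBestStablePerm F) {p : Equiv.Perm A}
    (hp : T.IsStablePerm T.graph p) (hsymm : p.symm = p) (z : A) :
    T.util z (F.symm z) ≤ T.util z (p z) := by
  have := hp.util_symm_le_of_util_le hF.isStablePerm (hF.util_le p hp hsymm) z
  rwa [hsymm] at this

theorem symm_util_le_util (hF : T.IsBestStablePerm F) (z : A) :
    T.util z (F.symm z) ≤ T.util z (F z) := by
  obtain ⟨p, hp, hsymm, h⟩ := hF.attained z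
  rw [← h]
  exact hF.symm_util_le hp hsymm z

/-- The edges of a stable permutation between the worst and the best stable partners are stable
edges. -/
theorem stableSubtable_adj (hF : T.IsBestStablePerm F) {f : Equiv.Perm A}
    (hf : T.IsStablePerm T.graph f) (h1 : ∀ z, T.util z (F.symm z) ≤ T.util z (f z))
    (h2 : ∀ z, T.util z (f z) ≤ T.util z (F z)) {z : A} (hz : f z ≠ z) :
    T.stableSubtable.graph.Adj z (f z) := by
  -- The join `c` of `f` and `f.symm` lies above its inverse, as the median requires, and `f z` has
  -- the utility of `c z` or of `c.symm z`. The median with an involution that is best at `z`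
  -- attains the former, one that is worst at `z` the latter.
  obtain ⟨c, hc, -, hc1, hc2⟩ := hf.exists_sup hf.inv
  rw [Equiv.symm_symm] at hc2
  have hle : ∀ z, T.util z (c.symm z) ≤ T.util z (c z) := fun z => by
    rw [hc1, hc2]; omega
  rw [stableSubtable_adj_iff]
  refine ⟨hz, ?_⟩
  by_cases hcase : T.util z (f.symm z) ≤ T.util z (f z)
  · obtain ⟨p, hp, hsymm, hpz⟩ := hF.attained z
    obtain ⟨m, hm, hm1, hm2⟩ := hc.exists_median hle hp hsymm
    refine ⟨m, hm, hm1, hm.eq_of_util_eq (fun _ => hf.le (hf.adj z hz)) ?_⟩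
    have := h2 z
    rw [hm2, hc1, hc2, hpz]
    omega
  · obtain ⟨p, hp, hsymm, hpz⟩ := hF.attained_symm z
    obtain ⟨m, hm, hm1, hm2⟩ := hc.exists_median hle hp hsymm
    refine ⟨m, hm, hm1, hm.eq_of_util_eq (fun _ => hf.le (hf.adj z hz)) ?_⟩
    have := h1 z
    rw [hm2, hc1, hc2, hpz]
    omega

end IsBestStablePerm

end StableSubtable

/-! ### First and last agents -/

section Envelope

variable {T : RoommateInstance A}

/-- The permutation `f` maps every agent to the first agent on its list in the subtable with edge
set `G`, and its inverse maps every agent to the last one. -/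
structure IsEnvelope (T : RoommateInstance A) (G : SimpleGraph A) (f : Equiv.Perm A) : Prop where
  le : G ≤ T.graph
  adj : ∀ z, f z ≠ z → G.Adj z (f z)
  util_le : ∀ z w, G.Adj z w → T.util z w ≤ T.util z (f z)
  le_util : ∀ z w, G.Adj z w → T.util z (f.symm z) ≤ T.util z w

theorem IsBestStablePerm.isEnvelope [Finite A] {F : Equiv.Perm A} (hF : T.IsBestStablePerm F) :
    T.IsEnvelope T.stableSubtable.graph F where
  le := stableSubtable_graph_le
  adj z hz := hF.stableSubtable_adj hF.isStablePerm hF.symm_util_le_util (fun _ => le_rfl) hz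
  util_le z w h := by
    obtain ⟨-, p, hp, hsymm, rfl⟩ := stableSubtable_adj_iff.1 h
    exact hF.util_le p hp hsymm z
  le_util z w h := by
    obtain ⟨-, p, hp, hsymm, rfl⟩ := stableSubtable_adj_iff.1 h
    exact hF.symm_util_le hp hsymm z

namespace IsEnvelope

variable {T' : RoommateInstance A} {f : Equiv.Perm A}

theorem symm_util_le_util {G : SimpleGraph A} (h : T.IsEnvelope G f) (z : A) :
    T.util z (f.symm z) ≤ T.util z (f z) := by
  by_cases hz : f z = z
  · rw [(f.symm_apply_eq).2 hz.symm, hz]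
  · exact h.le_util z _ (h.adj z hz)

theorem apply_ne {G : SimpleGraph A} (h : T.IsEnvelope G f) {z w : A} (hzw : G.Adj z w) :
    f z ≠ z := by
  intro h'
  have h1 := h.util_le z w hzw
  have h2 := T.util_pos_iff.2 (h.le hzw)
  rw [h', T.util_self] at h1
  omega

theorem symm_adj {G : SimpleGraph A} (h : T.IsEnvelope G f) {z : A} (hz : f.symm z ≠ z) :
    G.Adj z (f.symm z) := by
  have := h.adj (f.symm z) (by simpa using hz.symm)
  simpa using this.symm

variable [Finite A]

theorem isFirst_iff (h : T.IsEnvelope T'.graph f) (hpref : T'.prefers = T.prefers) {z w : A} :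
    T'.IsFirst z w ↔ f z = w ∧ w ≠ z := by
  constructor
  · rintro ⟨h1, h2⟩
    refine ⟨?_, h1.ne'⟩
    by_contra hne
    have h3 := h.adj z (h.apply_ne h1)
    have h4 := h2 _ h3 hne
    rw [hpref] at h4
    have h5 := T.util_lt_of_prefers (h.le h1) (h.le h3) h4
    have h6 := h.util_le z w h1
    omega
  · rintro ⟨rfl, hz⟩
    refine ⟨h.adj z hz, fun u hu hne => ?_⟩
    rw [hpref]
    exact (T.util_lt_iff (h.le (h.adj z hz)) (h.le hu)).1 (lt_of_le_of_ne (h.util_le z u hu)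
      fun h' => hne (T.util_inj (h.le hu) h'))

theorem isLast_iff (h : T.IsEnvelope T'.graph f) (hpref : T'.prefers = T.prefers) {z w : A} :
    T'.IsLast z w ↔ f.symm z = w ∧ w ≠ z := by
  constructor
  · rintro ⟨h1, h2⟩
    refine ⟨?_, h1.ne'⟩
    by_contra hne
    have h0 : f.symm z ≠ z := fun h' => h.apply_ne h1 (by
      conv_lhs => rw [← h']
      simp)
    have h3 := h.symm_adj h0
    have h4 := h2 _ h3 hne
    rw [hpref] at h4
    have h5 := T.util_lt_of_prefers (h.le h3) (h.le h1) h4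
    have h6 := h.le_util z w h1
    omega
  · rintro ⟨rfl, hz⟩
    refine ⟨h.symm_adj hz, fun u hu hne => ?_⟩
    rw [hpref]
    exact (T.util_lt_iff (h.le hu) (h.le (h.symm_adj hz))).1 (lt_of_le_of_ne (h.le_util z u hu)
      fun h' => hne (T.util_inj (h.le hu) h'.symm))

theorem isFirst_iff_isLast (h : T.IsEnvelope T'.graph f) (hpref : T'.prefers = T.prefers)
    (z w : A) : T'.IsFirst z w ↔ T'.IsLast w z := by
  rw [h.isFirst_iff hpref, h.isLast_iff hpref, Equiv.symm_apply_eq]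
  exact ⟨fun h => ⟨h.1.symm, h.2.symm⟩, fun h => ⟨h.1.symm, h.2.symm⟩⟩

/-- A sufficient condition for validity of a subtable. -/
theorem isValidSubtable (h : T.IsEnvelope T'.graph f) (hpref : T'.prefers = T.prefers)
    {T₁ : RoommateInstance A} (hle : T'.graph ≤ T₁.graph) (hT₁ : T₁.graph ≤ T.graph)
    (hpref₁ : T₁.prefers = T.prefers)
    (hne : ∀ z w, T₁.graph.Adj z w → f z ≠ z)
    (hmem : ∀ z w, T₁.graph.Adj z w → T.util z (f.symm z) ≤ T.util z w →
      T.util w (f.symm w) ≤ T.util w z → T'.graph.Adj z w) :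
    T'.IsValidSubtable T₁ where
  isSubtable := ⟨hle, fun _ _ _ _ _ => by rw [hpref, hpref₁]⟩
  nonempty := fun z ⟨w, hw⟩ => ⟨f z, h.adj z (hne z w hw)⟩
  first_iff_last := h.isFirst_iff_isLast hpref
  not_adj_iff z w hzw := by
    have key : ∀ z w, T₁.graph.Adj z w → ((∃ l, T'.IsLast z l ∧ T₁.prefers z l w) ↔
        T.util z w < T.util z (f.symm z)) := by
      intro z w hzw
      constructor
      · rintro ⟨l, hl, hlw⟩
        rw [h.isLast_iff hpref] at hl
        obtain ⟨rfl, hl⟩ := hl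
        rw [hpref₁] at hlw
        exact T.util_lt_of_prefers (h.le (h.symm_adj hl)) (hT₁ hzw) hlw
      · intro hlt
        have hl : f.symm z ≠ z := fun h' => by
          rw [h', T.util_self] at hlt
          omega
        refine ⟨f.symm z, (h.isLast_iff hpref).2 ⟨rfl, hl⟩, ?_⟩
        rw [hpref₁]
        exact (T.util_lt_iff (h.le (h.symm_adj hl)) (hT₁ hzw)).1 hlt
    rw [key z w hzw, key w z hzw.symm]
    constructor
    · intro hn
      by_contra! hb
      exact hn (hmem z w hzw hb.1 hb.2)
    · intro hlt hadj
      have h1 := h.le_util z w hadj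
      have h2 := h.le_util w z hadj.symm
      omega

end IsEnvelope

end Envelope

end RoommateInstance

/-- Cyclic induction: adding one repeatedly reaches every index. -/
theorem Fin.forall_of_forall_add_one {r : ℕ} [NeZero r] {P : Fin r → Prop}
    (h : ∀ i, P i → P (i + 1)) {i₀ : Fin r} (h₀ : P i₀) (i : Fin r) : P i := by
  have key : ∀ n : ℕ, P (i₀ + Fin.ofNat r n) := by
    intro n
    induction n with
    | zero => simpa using h₀
    | succ n ih =>
      have h1 := h _ ih
      have h2 : Fin.ofNat r (n + 1) = Fin.ofNat r n + 1 := by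
        ext
        simp [Fin.val_add]
      rwa [h2, ← add_assoc]
  have h1 := key (i - i₀).val
  simpa using h1

/-! ### Valid subtables and non-singular rotations -/

namespace RoommateInstance

variable {A : Type*} [Finite A] {T : RoommateInstance A}

theorem IsFirst.util_le {T' : RoommateInstance A} (hle : T'.graph ≤ T.graph)
    (hpref : ∀ z a b, T'.graph.Adj z a → T'.graph.Adj z b → T'.prefers z a b → T.prefers z a b)
    {z w u : A} (h : T'.IsFirst z w) (hu : T'.graph.Adj z u) : T.util z u ≤ T.util z w := by
  by_cases hne : u = w
  · rw [hne]
  · exact (T.util_lt_of_prefers (hle h.1) (hle hu) (hpref z w u h.1 hu (h.2 u hu hne))).le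

theorem IsLast.util_le {T' : RoommateInstance A} (hle : T'.graph ≤ T.graph)
    (hpref : ∀ z a b, T'.graph.Adj z a → T'.graph.Adj z b → T'.prefers z a b → T.prefers z a b)
    {z w u : A} (h : T'.IsLast z w) (hu : T'.graph.Adj z u) : T.util z w ≤ T.util z u := by
  by_cases hne : u = w
  · rw [hne]
  · exact (T.util_lt_of_prefers (hle hu) (hle h.1) (hpref z u w hu h.1 (h.2 u hu hne))).le

theorem exists_isFirst (T : RoommateInstance A) {z w : A} (h : T.graph.Adj z w) :
    ∃ v, T.IsFirst z v := by
  obtain ⟨v, hv, hmax⟩ := Set.exists_max_image {v | T.graph.Adj z v} (T.util z) (Set.toFinite _)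
    ⟨w, h⟩
  exact ⟨v, hv, fun u hu hne => (T.util_lt_iff hv hu).1
    (lt_of_le_of_ne (hmax u hu) fun h' => hne (T.util_inj hu h'))⟩

theorem exists_isLast (T : RoommateInstance A) {z w : A} (h : T.graph.Adj z w) :
    ∃ v, T.IsLast z v := by
  obtain ⟨v, hv, hmin⟩ := Set.exists_min_image {v | T.graph.Adj z v} (T.util z) (Set.toFinite _)
    ⟨w, h⟩
  exact ⟨v, hv, fun u hu hne => (T.util_lt_iff hu hv).1
    (lt_of_le_of_ne (hmin u hu) fun heq => hne (T.util_inj hu heq.symm))⟩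

/-- A valid subtable gives rise to a stable permutation. -/
theorem IsValidSubtable.exists_isEnvelope {T' T'' : RoommateInstance A}
    (h : T''.IsValidSubtable T') (hle : T'.graph ≤ T.graph) (hpref : T'.prefers = T.prefers) :
    ∃ f, T.IsEnvelope T''.graph f ∧ T.IsStablePerm T'.graph f ∧
      (∀ z w, T''.IsFirst z w → f z = w) ∧
      ∀ z w, T'.graph.Adj z w → T.util z (f.symm z) ≤ T.util z w →
        T.util w (f.symm w) ≤ T.util w z → T''.graph.Adj z w := by
  classical
  have hle'' : T''.graph ≤ T.graph := h.isSubtable.1.trans hle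
  have hpref'' : ∀ z a b, T''.graph.Adj z a → T''.graph.Adj z b → T''.prefers z a b →
      T.prefers z a b := fun z a b ha hb hab => by
    have := (h.isSubtable.2 z a b ha hb).1 hab
    rwa [hpref] at this
  have hex : ∀ z, ∃ w, T''.IsFirst z w ∨ (z = w ∧ ∀ v, ¬ T''.graph.Adj z v) := by
    intro z
    by_cases hz : ∃ w, T''.graph.Adj z w
    · obtain ⟨w, hw⟩ := hz
      exact (T''.exists_isFirst hw).imp fun _ => Or.inl
    · exact ⟨z, Or.inr ⟨rfl, not_exists.1 hz⟩⟩
  choose f₀ hf₀ using hex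
  have huniq : ∀ w z z', T''.IsLast w z → T''.IsLast w z' → z = z' := fun w z z' h1 h2 =>
    T.util_inj (hle'' h1.1)
      (le_antisymm (h1.util_le hle'' hpref'' h2.1) (h2.util_le hle'' hpref'' h1.1))
  -- If `w` is first for `z`, then `z` is last for `w`, and last agents are unique. Agents with
  -- empty lists are fixed points.
  have hinj : Function.Injective f₀ := by
    intro z z' hzz
    rcases hf₀ z with h1 | h1 <;> rcases hf₀ z' with h2 | h2
    · exact huniq _ z z' ((h.first_iff_last _ _).1 h1) (hzz ▸ (h.first_iff_last _ _).1 h2)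
    · rw [hzz, ← h2.1] at h1
      exact absurd h1.1.symm (h2.2 z)
    · rw [← hzz, ← h1.1] at h2
      exact absurd h2.1.symm (h1.2 z')
    · rw [h1.1, h2.1, hzz]
  let f : Equiv.Perm A := Equiv.ofBijective f₀ (Finite.injective_iff_bijective.1 hinj)
  have hf : ∀ z, T''.IsFirst z (f z) ∨ (z = f z ∧ ∀ v, ¬ T''.graph.Adj z v) := hf₀
  have hfirst : ∀ z w, T''.IsFirst z w → f z = w := by
    intro z w hzw
    rcases hf z with h1 | h1
    · exact T.util_inj (hle'' h1.1)
        (le_antisymm (hzw.util_le hle'' hpref'' h1.1) (h1.util_le hle'' hpref'' hzw.1))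
    · exact absurd hzw.1 (h1.2 w)
  have hlast : ∀ w z, T''.IsLast w z → f.symm w = z := by
    intro w z hwz
    rw [Equiv.symm_apply_eq, hfirst z w ((h.first_iff_last _ _).2 hwz)]
  have henv : T.IsEnvelope T''.graph f := by
    refine ⟨hle'', fun z hz => ?_, fun z w hzw => ?_, fun z w hzw => ?_⟩
    · rcases hf z with h1 | h1
      · exact h1.1
      · exact absurd h1.1.symm hz
    · rcases hf z with h1 | h1
      · exact h1.util_le hle'' hpref'' hzw
      · exact absurd hzw (h1.2 w)
    · obtain ⟨l, hl⟩ := T''.exists_isLast hzw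
      rw [hlast z l hl]
      exact hl.util_le hle'' hpref'' hzw
  have hbelow : ∀ z w, T'.graph.Adj z w → (∃ l, T''.IsLast z l ∧ T'.prefers z l w) →
      T.util z w < T.util z (f.symm z) ∧ T.util z w < T.util z (f z) := by
    rintro z w hzw ⟨l, hl, hlw⟩
    rw [hpref] at hlw
    have h1 := T.util_lt_of_prefers (hle'' hl.1) (hle hzw) hlw
    have h2 := henv.util_le z l hl.1
    rw [hlast z l hl]
    omega
  refine ⟨f, henv, ⟨hle, fun z hz => h.isSubtable.1 (henv.adj z hz), fun z w hzw => ?_⟩, hfirst,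
    fun z w hzw h1 h2 => ?_⟩
  · by_cases hadj : T''.graph.Adj z w
    · exact Or.inl (henv.util_le z w hadj)
    · rcases (h.not_adj_iff z w hzw).1 hadj with h1 | h1
      · exact Or.inl (hbelow z w hzw h1).2.le
      · exact Or.inr (hbelow w z hzw.symm h1).1.le
  · by_contra hadj
    rcases (h.not_adj_iff z w hzw).1 hadj with h3 | h3
    · have := (hbelow z w hzw h3).1
      omega
    · have := (hbelow w z hzw.symm h3).1
      omega

/-- A non-singular rotation exposed in a solvable valid table is contained in a stable matching. -/
theorem exists_isStablePerm_apply_eq {T' : RoommateInstance A} (hle : T'.graph ≤ T.graph)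
    (hpref : T'.prefers = T.prefers) {p : Equiv.Perm A} (hp : T.IsStablePerm T'.graph p)
    (hsymm : p.symm = p) {ρ : PairSequence A} (hρ : T'.IsExposedRotation T' ρ)
    (hdual : ρ.dual ∈ T'.rotations) :
    ∃ m, T.IsStablePerm T'.graph m ∧ m.symm = m ∧ ∀ i, m (ρ.x i) = ρ.y i := by
  classical
  obtain ⟨T'', hval, hexp⟩ := hdual
  replace hexp : ∀ i : Fin ρ.r, T''.IsFirst (ρ.y (i + 1)) (ρ.x i) ∧
    T''.IsSecond (ρ.y (i + 1)) (ρ.x (i + 1)) := hexp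
  obtain ⟨f, henv, hf, hfirst, hmem⟩ := hval.exists_isEnvelope hle hpref
  have hle'' : T''.graph ≤ T.graph := hval.isSubtable.1.trans hle
  have hpref' : ∀ z a b, T'.graph.Adj z a → T'.graph.Adj z b → T'.prefers z a b →
      T.prefers z a b := fun z a b _ _ h => by rwa [hpref] at h
  have hpref'' : ∀ z a b, T''.graph.Adj z a → T''.graph.Adj z b → T''.prefers z a b →
      T.prefers z a b := fun z a b ha hb hab =>
    hpref' z a b (hval.isSubtable.1 ha) (hval.isSubtable.1 hb)
      ((hval.isSubtable.2 z a b ha hb).1 hab)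
  have hfe := henv.symm_util_le_util
  have hyx : ∀ i, f (ρ.y (i + 1)) = ρ.x i := fun i => hfirst _ _ (hexp i).1
  have hadj : ∀ i, T''.graph.Adj (ρ.y i) (ρ.x i) := by
    intro i
    have h := (hexp (i - 1)).2.1
    rwa [sub_add_cancel] at h
  have hxy : ∀ i, f (ρ.x i) = ρ.y i := by
    intro i
    have h0 := henv.apply_ne (hadj i).symm
    have h1 := henv.util_le _ _ (hadj i).symm
    have h2 := henv.adj _ h0
    exact T.util_inj (hle'' h2)
      (le_antisymm ((hρ.2 i).1.util_le hle hpref' (hval.isSubtable.1 h2)) h1)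
  have hsxy : ∀ i, f.symm (ρ.y i) = ρ.x i := fun i => by rw [Equiv.symm_apply_eq, hxy]
  -- In `T''` the second agent of `ρ.y (i + 1)` is also its last, so its list has just two entries.
  have hnbr : ∀ i w, T''.graph.Adj (ρ.y (i + 1)) w → w = ρ.x i ∨ w = ρ.x (i + 1) := by
    intro i w hw
    by_contra! hne
    obtain ⟨h1, v, hv, hv2, hv3⟩ := (hexp i).2
    have hv4 : v = ρ.x i := (hfirst _ _ hv).symm.trans (hyx i)
    have h5 := hpref'' _ _ _ h1 hw (hv3 w hw (hv4 ▸ hne.1) hne.2)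
    have h6 := T.util_lt_of_prefers (hle'' h1) (hle'' hw) h5
    have h7 := henv.le_util _ _ hw
    rw [hsxy] at h7
    exact absurd h7 (not_le.2 h6)
  have hyne : ∀ i, ρ.y i ≠ ρ.y (i + 1) := by
    intro i h
    obtain ⟨h1, v, hv, hv2, hv3⟩ := (hρ.2 i).2
    refine hv2 (Eq.trans ?_ h)
    exact T.util_inj (hle hv.1) (le_antisymm ((hρ.2 i).1.util_le hle hpref' hv.1)
      (hv.util_le hle hpref' (hρ.2 i).1.1))
  -- Pushing `p` between `f.symm` and `f` gives a stable matching inside `T''`, which therefore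
  -- matches each `ρ.y (i + 1)` to one of two agents. By injectivity the choice is the same around
  -- the cycle.
  obtain ⟨m, hm, hmsymm, hmu⟩ := hf.exists_median hfe hp hsymm
  have hmm := apply_apply_of_symm_eq hmsymm
  have hm1 : ∀ z, T.util z (f.symm z) ≤ T.util z (m z) := fun z => by rw [hmu]; omega
  have hm2 : ∀ z, T.util z (m z) ≤ T.util z (f z) := fun z => by
    have := hfe z
    rw [hmu]; omega
  have hmadj : ∀ z, m z ≠ z → T''.graph.Adj z (m z) := by
    intro z hz
    refine hmem _ _ (hm.adj z hz) (hm1 z) ?_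
    have := hm1 (m z)
    rwa [hmm] at this
  have hmy : ∀ i, m (ρ.y (i + 1)) = ρ.x i ∨ m (ρ.y (i + 1)) = ρ.x (i + 1) := by
    intro i
    refine hnbr i _ (hmadj _ fun h => ?_)
    have h1 := hm1 (ρ.y (i + 1))
    rw [h, T.util_self, hsxy] at h1
    have := T.util_pos_iff.2 (hle'' (hadj (i + 1)))
    omega
  by_cases hall : ∃ i, m (ρ.y i) = ρ.x i
  · obtain ⟨i₀, h₀⟩ := hall
    have hall : ∀ i, m (ρ.y i) = ρ.x i := by
      refine Fin.forall_of_forall_add_one (fun i hi => (hmy i).resolve_left fun h => ?_) h₀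
      exact hyne i (m.injective (hi.trans h.symm))
    exact ⟨m, hm, hmsymm, fun i => by rw [← hall, hmm]⟩
  · have hmy' : ∀ i, m (ρ.y (i + 1)) = ρ.x i := fun i =>
      (hmy i).resolve_right (not_exists.1 hall _)
    have hmx : ∀ i, m (ρ.x i) = ρ.y (i + 1) := fun i => by rw [← hmy', hmm]
    have hdisj : ∀ i j, ρ.x i ≠ ρ.y j := by
      intro i j h
      obtain ⟨k, rfl⟩ : ∃ k, j = k + 1 := ⟨j - 1, (sub_add_cancel j 1).symm⟩
      have h1 := hmx i
      have h2 := hxy i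
      rw [h, hmy'] at h1
      rw [h, hyx] at h2
      exact hyne i (h2.symm.trans h1)
    let X : Set A := Set.range ρ.x
    let Y : Set A := Set.range ρ.y
    -- Here `m` contains the pairs of `ρ.x i` and `ρ.y (i + 1)`; rotate them to `ρ.x i`, `ρ.y i`.
    let q : A → A := fun z => if z ∈ X then f z else if z ∈ Y then f.symm z else m z
    have hqx : ∀ i, q (ρ.x i) = ρ.y i := fun i => by
      simp only [q]
      rw [if_pos ⟨i, rfl⟩, hxy]
    have hyX : ∀ i, ρ.y i ∉ X := fun i ⟨j, hj⟩ => hdisj _ _ hj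
    have hqy : ∀ i, q (ρ.y i) = ρ.x i := fun i => by
      simp only [q]
      rw [if_neg (hyX i), if_pos ⟨i, rfl⟩, hsxy]
    have hqm : ∀ z, z ∉ X → z ∉ Y → q z = m z := fun z h1 h2 => by
      simp only [q]
      rw [if_neg h1, if_neg h2]
    have hinv : Function.Involutive q := by
      intro z
      by_cases hX : z ∈ X
      · obtain ⟨i, rfl⟩ := hX
        rw [hqx, hqy]
      by_cases hY : z ∈ Y
      · obtain ⟨i, rfl⟩ := hY
        rw [hqy, hqx]
      rw [hqm z hX hY, hqm, hmm]
      · rintro ⟨i, hi⟩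
        refine hY ⟨i + 1, ?_⟩
        rw [← hmx, hi, hmm]
      · rintro ⟨i, hi⟩
        obtain ⟨k, rfl⟩ : ∃ k, i = k + 1 := ⟨i - 1, (sub_add_cancel i 1).symm⟩
        refine hX ⟨k, ?_⟩
        rw [← hmy', hi, hmm]
    have hq1 : ∀ z, T.util z (f.symm z) ≤ T.util z (q z) := by
      intro z
      by_cases hX : z ∈ X
      · obtain ⟨i, rfl⟩ := hX
        rw [hqx, ← hxy]
        exact hfe _
      by_cases hY : z ∈ Y
      · obtain ⟨i, rfl⟩ := hY
        rw [hqy, hsxy]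
      rw [hqm z hX hY]
      exact hm1 z
    have hq2 : ∀ z, z ∉ Y → T.util z (m z) ≤ T.util z (q z) := by
      intro z hY
      by_cases hX : z ∈ X
      · obtain ⟨i, rfl⟩ := hX
        rw [hqx, ← hxy]
        exact hm2 _
      rw [hqm z hX hY]
    -- Only the agents in `Y` may lose. An edge blocking at one of them lies in `T''`, so it leads
    -- either to its partner in `q` or to some `ρ.x k`, which already has its first choice.
    have hY : ∀ z w, z ∈ Y → T'.graph.Adj z w → T.util z (q z) < T.util z w →
        T.util w (q w) < T.util w z → False := by
      intro z w hz hzw h1 h2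
      have h3 := hmem z w hzw ((hq1 z).trans h1.le) ((hq1 w).trans h2.le)
      obtain ⟨j, rfl⟩ := hz
      obtain ⟨k, rfl⟩ : ∃ k, j = k + 1 := ⟨j - 1, (sub_add_cancel j 1).symm⟩
      rcases hnbr k w h3 with rfl | rfl
      · have := henv.util_le _ _ h3.symm
        rw [hqx, ← hxy] at h2
        omega
      · rw [hqy] at h1
        exact h1.false
    refine ⟨hinv.toPerm q, ⟨hle, fun z hz => ?_, fun z w hzw => ?_⟩,
      Function.Involutive.toPerm_symm hinv, hqx⟩
    · change T'.graph.Adj z (q z)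
      change q z ≠ z at hz
      by_cases hX : z ∈ X
      · obtain ⟨i, rfl⟩ := hX
        rw [hqx]
        exact hval.isSubtable.1 (hadj i).symm
      by_cases hY : z ∈ Y
      · obtain ⟨i, rfl⟩ := hY
        rw [hqy]
        exact hval.isSubtable.1 (hadj i)
      rw [hqm z hX hY] at hz ⊢
      exact hm.adj z hz
    · rw [Function.Involutive.toPerm_symm hinv]
      change T.util z w ≤ T.util z (q z) ∨ T.util w z ≤ T.util w (q w)
      by_contra! hb
      by_cases hzY : z ∈ Y
      · exact hY z w hzY hzw hb.1 hb.2
      by_cases hwY : w ∈ Y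
      · exact hY w z hwY hzw.symm hb.2 hb.1
      have h1 := hm.stable z w hzw
      have h2 := hq2 z hzY
      have h3 := hq2 w hwY
      rw [hmsymm] at h1
      omega

end RoommateInstance

theorem PairSequence.graph_adj {A : Type*} (ρ : PairSequence A) {a b : A} :
    ρ.graph.Adj a b ↔ a ≠ b ∧ ((∃ i, ρ.x i = a ∧ ρ.y i = b) ∨ ∃ i, ρ.x i = b ∧ ρ.y i = a) :=
  SimpleGraph.fromRel_adj _ _ _

/-! ### Stitched rotations from alternating cycles -/

namespace RoommateInstance

variable {A : Type*} [Finite A] {T : RoommateInstance A}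

/-- Adding a sequence of pairs at the top of the lists of the agents `ρ.x i` and at the bottom of
the lists of the agents `ρ.y i`. -/
theorem IsEnvelope.exists_sup {H : SimpleGraph A} {E p : Equiv.Perm A} (hE : T.IsEnvelope H E)
    {ρ : PairSequence A} (hp : ∀ i, p (ρ.x i) = ρ.y i) (hnext : ∀ i, E (ρ.x i) = ρ.y (i + 1))
    (hdisj : ∀ i j, ρ.x i ≠ ρ.y j)
    (htop : ∀ i, T.util (ρ.x i) (E (ρ.x i)) < T.util (ρ.x i) (ρ.y i))
    (hbot : ∀ i, T.util (ρ.y i) (ρ.x i) < T.util (ρ.y i) (E.symm (ρ.y i))) :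
    ∃ f, T.IsEnvelope (H ⊔ ρ.graph) f ∧ (∀ i, f (ρ.x i) = ρ.y i) ∧
      (∀ z, z ∉ Set.range ρ.x → f z = E z) ∧
      ∀ z, z ∉ Set.range ρ.y → f.symm z = E.symm z := by
  classical
  let f₀ : A → A := fun z => if z ∈ Set.range ρ.x then p z else E z
  have hpos : ∀ i, f₀ (ρ.x i) = ρ.y i := fun i => (if_pos ⟨i, rfl⟩).trans (hp i)
  have hneg : ∀ z, z ∉ Set.range ρ.x → f₀ z = E z := fun z hz => if_neg hz
  -- `E` already sends the agents `ρ.x k` onto the agents `ρ.y i`, so switching to `p` there creates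
  -- no collision with the rest.
  have hE_range : ∀ i z, ρ.y i = E z → z ∈ Set.range ρ.x := by
    intro i z h
    obtain ⟨k, rfl⟩ : ∃ k, i = k + 1 := ⟨i - 1, (sub_add_cancel i 1).symm⟩
    rw [← hnext] at h
    exact ⟨k, E.injective h⟩
  have hinj : Function.Injective f₀ := by
    intro z z' h
    by_cases hz : z ∈ Set.range ρ.x <;> by_cases hz' : z' ∈ Set.range ρ.x
    · obtain ⟨i, rfl⟩ := hz
      obtain ⟨j, rfl⟩ := hz'
      rw [hpos, hpos, ← hp, ← hp] at h
      exact p.injective h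
    · obtain ⟨i, rfl⟩ := hz
      rw [hpos, hneg z' hz'] at h
      exact absurd (hE_range i z' h) hz'
    · obtain ⟨i, rfl⟩ := hz'
      rw [hpos, hneg z hz] at h
      exact absurd (hE_range i z h.symm) hz
    · rw [hneg z hz, hneg z' hz'] at h
      exact E.injective h
  let f : Equiv.Perm A := Equiv.ofBijective f₀ (Finite.injective_iff_bijective.1 hinj)
  have hfx : ∀ i, f (ρ.x i) = ρ.y i := hpos
  have hfE : ∀ z, z ∉ Set.range ρ.x → f z = E z := hneg
  have hfy : ∀ i, f.symm (ρ.y i) = ρ.x i := fun i => by rw [Equiv.symm_apply_eq, hfx]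
  have hfE' : ∀ z, z ∉ Set.range ρ.y → f.symm z = E.symm z := by
    intro w hw
    obtain ⟨z, rfl⟩ := f.surjective w
    by_cases hz : z ∈ Set.range ρ.x
    · obtain ⟨i, rfl⟩ := hz
      exact absurd ⟨i, (hfx i).symm⟩ hw
    · rw [Equiv.symm_apply_apply, hfE z hz, Equiv.symm_apply_apply]
  have hmid := hE.symm_util_le_util
  have hyx : ∀ i, ρ.y i ∉ Set.range ρ.x := fun i ⟨j, hj⟩ => hdisj j i hj
  have hxy : ∀ i, ρ.x i ∉ Set.range ρ.y := fun i ⟨j, hj⟩ => hdisj i j hj.symm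
  have hup : ∀ z, T.util z (E z) ≤ T.util z (f z) := by
    intro z
    by_cases hz : z ∈ Set.range ρ.x
    · obtain ⟨i, rfl⟩ := hz
      rw [hfx]
      exact (htop i).le
    · rw [hfE z hz]
  have hdown : ∀ z, T.util z (f.symm z) ≤ T.util z (E.symm z) := by
    intro z
    by_cases hz : z ∈ Set.range ρ.y
    · obtain ⟨i, rfl⟩ := hz
      rw [hfy]
      exact (hbot i).le
    · rw [hfE' z hz]
  have hbounds : ∀ z w, (H ⊔ ρ.graph).Adj z w →
      T.util z w ≤ T.util z (f z) ∧ T.util z (f.symm z) ≤ T.util z w := by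
    rintro z w (h | h)
    · exact ⟨(hE.util_le z w h).trans (hup z), (hdown z).trans (hE.le_util z w h)⟩
    · rcases (ρ.graph_adj.1 h).2 with ⟨i, rfl, rfl⟩ | ⟨i, rfl, rfl⟩
      · rw [hfx]
        exact ⟨le_rfl, (hdown _).trans ((hmid _).trans (htop i).le)⟩
      · rw [hfy]
        exact ⟨(hbot i).le.trans ((hmid _).trans (hup _)), le_rfl⟩
  refine ⟨f, ⟨sup_le hE.le fun a b h => ?_, fun z hz => ?_, fun z w h => (hbounds z w h).1,
    fun z w h => (hbounds z w h).2⟩, hfx, hfE, hfE'⟩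
  · have hadj : ∀ i, T.graph.Adj (ρ.x i) (ρ.y i) := fun i =>
      T.util_pos_iff.1 (Nat.zero_lt_of_lt (htop i))
    rcases (ρ.graph_adj.1 h).2 with ⟨i, rfl, rfl⟩ | ⟨i, rfl, rfl⟩
    · exact hadj i
    · exact (hadj i).symm
  · by_cases hzx : z ∈ Set.range ρ.x
    · obtain ⟨i, rfl⟩ := hzx
      rw [hfx]
      exact Or.inr (ρ.graph_adj.2 ⟨hdisj i i, Or.inl ⟨i, rfl, rfl⟩⟩)
    · rw [hfE z hzx] at hz ⊢
      exact Or.inl (hE.adj z hz)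

/-- Let `F` map every agent to its best stable partner, and let `p` be an involution that is
better than `F` on the agents `ρ.x i` and worse than every stable partner on the agents `ρ.y i`.
An alternating cycle `ρ` of `p` and `F` is a stitched rotation, provided that the edges of `F` on
the cycle belong to a stable involution `m` of `T*`. -/
theorem isStitchedRotation_of_forall {F p m : Equiv.Perm A} (hF : T.IsBestStablePerm F)
    (hsymm : p.symm = p) (hm : T.IsStablePerm T.stableSubtable.graph m) (hmsymm : m.symm = m)
    {ρ : PairSequence A} (hp : ∀ i, p (ρ.x i) = ρ.y i) (hnext : ∀ i, F (ρ.x i) = ρ.y (i + 1))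
    (hmx : ∀ i, m (ρ.x i) = ρ.y (i + 1))
    (htop : ∀ i, T.util (ρ.x i) (F (ρ.x i)) < T.util (ρ.x i) (ρ.y i))
    (hbot : ∀ i, T.util (ρ.y i) (ρ.x i) < T.util (ρ.y i) (F.symm (ρ.y i))) :
    T.IsStitchedRotation ρ := by
  have hpp := apply_apply_of_symm_eq hsymm
  have hpy : ∀ i, p (ρ.y i) = ρ.x i := fun i => by rw [← hp, hpp]
  have hmm := apply_apply_of_symm_eq hmsymm
  have hmy : ∀ i, m (ρ.y (i + 1)) = ρ.x i := fun i => by rw [← hmx, hmm]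
  have hFy : ∀ i, F.symm (ρ.y (i + 1)) = ρ.x i := fun i => by rw [Equiv.symm_apply_eq, hnext]
  have hadj : ∀ i, T.graph.Adj (ρ.x i) (ρ.y i) := fun i =>
    T.util_pos_iff.1 (Nat.zero_lt_of_lt (htop i))
  have hmid := hF.symm_util_le_util
  have henv := hF.isEnvelope
  have hdisj : ∀ i j, ρ.x i ≠ ρ.y j := by
    intro i j h
    have h1 := htop i
    have h2 := hbot j
    have h3 := hmid (ρ.x i)
    rw [← hp, h, hpy] at h1
    rw [h] at h3
    omega
  have hyy : ∀ i, ρ.y i ≠ ρ.y (i + 1) := fun i h => by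
    have := htop i
    rw [hnext, ← h] at this
    exact this.false
  have hxx : ∀ i, ρ.x i ≠ ρ.x (i + 1) := fun i h => hyy i (by rw [← hp, ← hp, h])
  -- Agents unmatched in `m` need a separate argument: stable permutations match the same agents, so
  -- these have no worst stable partner either.
  have hleT : ∀ z, T.util z (m z) ≤ T.util z (F z) ∧ T.util z (F.symm z) ≤ T.util z (m z) := by
    intro z
    by_cases hz : m z = z
    · have h0 : ¬ T.util z (F.symm z) > 0 := fun h => by
        have h1 : F.symm z ≠ z := fun h' => by
          rw [h', T.util_self] at h
          exact h.false
        have hFst : T.IsStablePerm T.stableSubtable.graph F :=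
          hF.isStablePerm.mono henv.le henv.adj
        exact hm.ne_self_of_ne_self hFst.inv h1 hz
      rw [hz, T.util_self]
      omega
    · exact ⟨henv.util_le z _ (hm.adj z hz), henv.le_util z _ (hm.adj z hz)⟩
  have hρle : ρ.graph ≤ T.graph := by
    intro a b h
    rcases (ρ.graph_adj.1 h).2 with ⟨i, rfl, rfl⟩ | ⟨i, rfl, rfl⟩
    · exact hadj i
    · exact (hadj i).symm
  have hρadj : ∀ i, ρ.graph.Adj (ρ.x i) (ρ.y i) := fun i =>
    ρ.graph_adj.2 ⟨hdisj i i, Or.inl ⟨i, rfl, rfl⟩⟩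
  have hρnbr : ∀ i w, ρ.graph.Adj (ρ.x i) w → w = ρ.y i := by
    intro i w h
    rcases (ρ.graph_adj.1 h).2 with ⟨j, h1, rfl⟩ | ⟨j, rfl, h1⟩
    · rw [← hp, ← hp, h1]
    · exact absurd h1.symm (hdisj i j)
  have hρnbr' : ∀ i w, ρ.graph.Adj (ρ.y i) w → w = ρ.x i := by
    intro i w h
    rcases (ρ.graph_adj.1 h).2 with ⟨j, h1, rfl⟩ | ⟨j, rfl, h1⟩
    · exact absurd h1 (hdisj j i)
    · rw [← hpy, ← hpy, h1]
  have hFirst := fun z w => henv.isFirst_iff (z := z) (w := w) (T' := T.stableSubtable) rfl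
  have hLast := fun z w => henv.isLast_iff (z := z) (w := w) (T' := T.stableSubtable) rfl
  have hFx : ∀ i, F (ρ.x i) ≠ ρ.x i := fun i h => hdisj i (i + 1) (by rw [← hnext, h])
  have hFy' : ∀ i, F.symm (ρ.y i) ≠ ρ.y i := fun i h => by
    have := hbot i
    rw [h, T.util_self] at this
    omega
  -- the table `T* ∪ ρ`
  obtain ⟨f, hf, hfx, hfF, hfF'⟩ := henv.exists_sup hp hnext hdisj htop hbot
  have hG : (T.union T.stableSubtable ρ).graph = T.stableSubtable.graph ⊔ ρ.graph :=
    inf_eq_right.2 (sup_le henv.le hρle)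
  rw [← hG] at hf
  have hpref : (T.union T.stableSubtable ρ).prefers = T.prefers := rfl
  have hexp : (T.union T.stableSubtable ρ).IsExposedRotation (T.union T.stableSubtable ρ) ρ := by
    refine ⟨hf.isValidSubtable hpref le_rfl hf.le hpref (fun _ _ => hf.apply_ne)
      fun _ _ h _ _ => h, fun i => ?_⟩
    have h1 : (T.union T.stableSubtable ρ).IsFirst (ρ.x i) (ρ.y i) :=
      (hf.isFirst_iff hpref).2 ⟨hfx i, (hdisj i i).symm⟩
    have h2 : T.stableSubtable.graph.Adj (ρ.x i) (ρ.y (i + 1)) := by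
      rw [← hnext]
      exact henv.adj _ (hFx i)
    refine ⟨h1, by rw [hG]; exact Or.inl h2, _, h1, hyy i, fun u hu hu1 hu2 => ?_⟩
    rw [hG] at hu
    rcases hu with hu | hu
    · have h3 := henv.util_le _ _ hu
      rw [hnext] at h3
      exact (T.util_lt_iff (henv.le h2) (henv.le hu)).1 (lt_of_le_of_ne h3 fun h' =>
        hu2 (T.util_inj (henv.le hu) h'))
    · exact absurd (hρnbr i u hu) hu1
  refine ⟨fun i => ⟨hadj i, fun h => ?_,
    Or.inl ⟨⟨⟨F (ρ.x i), ?_, ?_⟩, F.symm (ρ.y i), ?_, ?_⟩, ?_⟩⟩, hexp, ⟨_, hexp⟩, ?_⟩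
  · have := henv.util_le _ _ h
    have := htop i
    omega
  · exact (hFirst _ _).2 ⟨rfl, hFx i⟩
  · exact (T.util_lt_iff (hadj i) (henv.le (henv.adj _ (hFx i)))).1 (htop i)
  · exact (hLast _ _).2 ⟨rfl, hFy' i⟩
  · exact (T.util_lt_iff (henv.le (henv.symm_adj (hFy' i))) (hadj i).symm).1 (hbot i)
  · rintro ⟨-, l, hl, hlt⟩
    have h1 := T.util_lt_of_prefers (henv.le hl.1) (hadj i) hlt
    have h2 := henv.util_le _ _ hl.1
    have h3 := htop i
    omega
  -- the dual rotation is exposed in the table consisting of `m` and `ρ`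
  obtain ⟨N, hN⟩ := exists_graph_isPartnerPerm hmsymm
  have hNle : N ≤ T.stableSubtable.graph := ((hN.isStablePerm_iff henv.le).1 hm).1
  have henvN : T.IsEnvelope N m := by
    refine ⟨hNle.trans henv.le, fun z => hN.adj_apply, fun z w h => ?_, fun z w h => ?_⟩
    · rw [((hN.2 z w).1 h).1]
    · rw [hmsymm, ((hN.2 z w).1 h).1]
  obtain ⟨k, hk, hkx, hkm, hkm'⟩ := henvN.exists_sup hp hmx hdisj
    (fun i => by rw [hmx, ← hnext]; exact htop i)
    (fun i => (hbot i).trans_le (by rw [hmsymm]; exact (hleT _).2))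
  have hG' : (T.restrict (N ⊔ ρ.graph)).graph = N ⊔ ρ.graph := inf_eq_right.2 hk.le
  have hpref' : (T.restrict (N ⊔ ρ.graph)).prefers = T.prefers := rfl
  rw [← hG'] at hk
  have hky : ∀ i, k (ρ.y (i + 1)) = ρ.x i := fun i => by
    rw [hkm _ fun ⟨j, hj⟩ => hdisj j _ hj, hmy]
  have hval : (T.restrict (N ⊔ ρ.graph)).IsValidSubtable (T.union T.stableSubtable ρ) := by
    refine hk.isValidSubtable hpref' ?_ hf.le hpref (fun z w h => ?_) fun z w h h1 h2 => ?_
    · rw [hG, hG']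
      exact sup_le_sup_right hNle _
    · rw [hG] at h
      rcases h with h | h
      · have h3 : 0 < T.util z (m z) := by
          refine lt_of_lt_of_le ?_ (hleT z).2
          refine T.util_pos_iff.2 (henv.le (henv.symm_adj fun h' => henv.apply_ne h ?_))
          conv_lhs => rw [← h']
          simp
        refine hk.apply_ne (w := m z) ?_
        rw [hG']
        refine Or.inl (hN.adj_apply fun h' => ?_)
        rw [h', T.util_self] at h3
        exact h3.false
      · refine hk.apply_ne (w := w) ?_
        rw [hG']
        exact Or.inr h
    · rw [hG] at h
      rw [hG']
      rcases h with h | h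
      · left
        -- Adding `ρ` lowers the bound only for the agents `ρ.y i`, and for those `m` already gives
        -- the worst agent in `T*`. Thus a surviving edge of `T*` is weakly above `m` at both ends,
        -- and stability of `m` makes it an edge of `m`.
        have key : ∀ z w, T.stableSubtable.graph.Adj z w → T.util z (k.symm z) ≤ T.util z w →
            T.util z (m z) ≤ T.util z w := by
          intro z w h h1
          by_cases hz : z ∈ Set.range ρ.y
          · obtain ⟨i, rfl⟩ := hz
            obtain ⟨j, rfl⟩ : ∃ j, i = j + 1 := ⟨i - 1, (sub_add_cancel i 1).symm⟩
            have := henv.le_util _ _ h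
            rwa [hmy, ← hFy]
          · rwa [hkm' z hz, hmsymm] at h1
        have h3 := key z w h h1
        have h4 := key w z h.symm h2
        have h5 := hm.stable z w h
        rw [hmsymm] at h5
        rcases h5 with h5 | h5
        · exact (hN.2 z w).2 ⟨(T.util_inj (henv.le h) (le_antisymm h5 h3)).symm, h.ne'⟩
        · exact ((hN.2 w z).2
            ⟨(T.util_inj (henv.le h.symm) (le_antisymm h5 h4)).symm, h.ne⟩).symm
      · exact Or.inr h
  have hexp' : ∀ i : Fin ρ.r, (T.restrict (N ⊔ ρ.graph)).IsFirst (ρ.y (i + 1)) (ρ.x i) ∧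
      (T.restrict (N ⊔ ρ.graph)).IsSecond (ρ.y (i + 1)) (ρ.x (i + 1)) := by
    intro i
    have h1 : (T.restrict (N ⊔ ρ.graph)).IsFirst (ρ.y (i + 1)) (ρ.x i) :=
      (hk.isFirst_iff hpref').2 ⟨hky i, hdisj _ _⟩
    refine ⟨h1, by rw [hG']; exact Or.inr (hρadj (i + 1)).symm, _, h1, hxx i,
      fun u hu hu1 hu2 => ?_⟩
    rw [hG'] at hu
    rcases hu with hu | hu
    · exact absurd (((hN.2 _ _).1 hu).1.symm.trans (hmy i)) hu1
    · exact absurd (hρnbr' _ _ hu) hu2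
  exact ⟨_, hval, hexp'⟩

end RoommateInstance

/-- The orbit of `x₀` under a permutation, as a cyclic sequence. -/
theorem PairSequence.exists_of_perm {A : Type*} [Finite A] (π : Equiv.Perm A) (x₀ : A)
    (p : A → A) : ∃ ρ : PairSequence A, (∀ i, ρ.x (i + 1) = π (ρ.x i)) ∧
      (∀ i, ∃ n : ℕ, ρ.x i = (π ^ n) x₀) ∧ ∀ i, ρ.y i = p (ρ.x i) := by
  have : NeZero (orderOf π) := ⟨(orderOf_pos π).ne'⟩
  have key : ∀ i : Fin (orderOf π), (π ^ (i + 1).val) x₀ = π ((π ^ i.val) x₀) := by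
    intro i
    rw [Fin.val_add, pow_mod_orderOf, pow_add, Fin.val_one', pow_mod_orderOf, pow_one,
      ← Equiv.Perm.mul_apply, ← pow_succ, ← pow_succ']
  exact ⟨⟨orderOf π, this, fun i => (π ^ i.val) x₀, fun i => p ((π ^ i.val) x₀)⟩, key,
    fun i => ⟨i.val, rfl⟩, fun _ => rfl⟩

/-! ### Unblocked matchings and stitched rotations -/

namespace RoommateInstance

variable {A : Type*} {T : RoommateInstance A}

theorem internallyStable_stableSubtable :
    T.InternallyStable T.stableSubtable.stableMatchings :=
  ⟨fun _ hN => ⟨hN.1.1.trans inf_le_left, hN.1.2⟩, fun _ hN₀ _ hN₁ ⟨a, b, hab, h⟩ =>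
    hN₁.2 a b ⟨hN₀.1.1 hab, h.2⟩⟩

theorem stableMatchings_subset_stableSubtable :
    T.stableMatchings ⊆ T.stableSubtable.stableMatchings := fun M hM =>
  ⟨⟨fun _ _ hab => ⟨hM.1.1 hab, M, hM, hab⟩, hM.1.2⟩, fun a b h => hM.2 a b ⟨h.1.1, h.2⟩⟩

variable [Finite A]

/-- An edge of a stable involution of a table between `T*` and `T` that lies strictly between the
worst and the best stable partner of an agent is a stable edge of `T`. -/
theorem IsBestStablePerm.stableSubtable_adj_of_lt {F p : Equiv.Perm A}
    (hF : T.IsBestStablePerm F) {G : SimpleGraph A} (hG : T.stableSubtable.graph ≤ G)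
    (hp : T.IsStablePerm G p) {x : A} (hlow : T.util x (F.symm x) < T.util x (p x))
    (htop : T.util x (p x) < T.util x (F x)) : T.stableSubtable.graph.Adj x (p x) := by
  by_contra hadj
  have hxy : G.Adj x (p x) := hp.adj_of_util_pos (Nat.zero_lt_of_lt hlow)
  cases nonempty_fintype A
  -- Take `g` minimal among the stable permutations between `F.symm` and `F` that put `x` strictly
  -- above `p x`. One step below `g`, the agent `x` drops to `p x` or lower.
  let K : Set (Equiv.Perm A) := {f | T.IsStablePerm T.graph f ∧
    (∀ z, T.util z (F.symm z) ≤ T.util z (f z)) ∧ (∀ z, T.util z (f z) ≤ T.util z (F z)) ∧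
    T.util x (p x) < T.util x (f x)}
  obtain ⟨g, ⟨hg, hg1, hg2, hg3⟩, hmin⟩ := Set.exists_min_image K
    (fun f => ∑ z, T.util z (f z)) (Set.toFinite _)
    ⟨F, hF.isStablePerm, hF.symm_util_le_util, fun _ => le_rfl, htop⟩
  obtain ⟨h, hh, hh1, hh2, hh3, hnext⟩ := hg.exists_lt hF.isStablePerm.inv hg1
    fun h => by rw [← h] at hg3; omega
  have hle : T.util x (h x) ≤ T.util x (p x) := by
    by_contra! hlt
    have h1 := hmin h ⟨hh, hh1, fun z => (hh2 z).trans (hg2 z), hlt⟩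
    obtain ⟨z, hz⟩ := hh3
    exact absurd h1 (not_le.2 (Finset.sum_lt_sum (fun i _ => hh2 i) ⟨z, Finset.mem_univ z, hz⟩))
  have hgG : T.IsStablePerm G g :=
    hg.mono hp.le fun z hz => hG (hF.stableSubtable_adj hg hg1 hg2 hz)
  -- Comparing `p` with `g` inside `G` shows that `p x` prefers `x` to its agent in `g`. So `p x` is
  -- a candidate for the next step, and `x` cannot drop below it.
  have hsymm := hp.util_symm_lt' hgG hg3
  rw [Equiv.symm_apply_apply] at hsymm
  have hle' := hnext x (fun h' => by rw [h'] at hle; omega) (p x) (hp.le hxy) hg3 hsymm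
  have heq : h x = p x :=
    hh.eq_of_util_eq (fun _ => hp.le hxy) (le_antisymm hle hle')
  refine hadj ?_
  rw [← heq]
  exact hF.stableSubtable_adj hh hh1 (fun z => (hh2 z).trans (hg2 z)) (by rw [heq]; exact hxy.symm.ne)

/-- A matching that is not blocked by any stable edge and contains an edge that is not stable gives
rise to a stitched rotation. -/
theorem exists_isStitchedRotation (hT : T.Solvable) {M : SimpleGraph A} (hM : M ∈ T.matchings)
    (hMS : M ∉ T.stableSubtable.stableMatchings)
    (hb : ∀ a b, T.stableSubtable.graph.Adj a b → ¬ T.EdgeBlocks a b M) :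
    ∃ ρ : PairSequence A, T.IsStitchedRotation ρ := by
  obtain ⟨F, hF⟩ := exists_isBestStablePerm hT
  obtain ⟨p, hpM⟩ := exists_isPartnerPerm hM.2
  have henv := hF.isEnvelope
  have hmid := hF.symm_util_le_util
  have hsymm := hpM.1
  have hpp := apply_apply_of_symm_eq hsymm
  have hGT : T.stableSubtable.graph ⊔ M ≤ T.graph := sup_le henv.le hM.1
  have hp : T.IsStablePerm (T.stableSubtable.graph ⊔ M) p := by
    refine (hpM.isStablePerm_iff hGT).2 ⟨le_sup_right, ?_⟩
    rintro a b (hab | hab)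
    · exact hb a b hab
    · exact fun h => T.prefers_irrefl a b h.1 (h.2.1 b hab)
  have hF1 : T.IsStablePerm (T.stableSubtable.graph ⊔ M) F :=
    hF.isStablePerm.mono hGT fun z hz => Or.inl (henv.adj z hz)
  have hout : ∀ z, p z ≠ z → ¬ T.stableSubtable.graph.Adj z (p z) →
      T.util z (F z) < T.util z (p z) ∨ T.util z (p z) < T.util z (F.symm z) := by
    intro z hz hadj
    by_contra! h
    have hne : ∀ {G}, ∀ f : Equiv.Perm A, T.IsStablePerm G f → G ≤ T.stableSubtable.graph →
        T.util z (f z) ≠ T.util z (p z) := fun f hf hG h' => hadj (by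
      have := hf.eq_of_util_eq (fun _ => hM.1 (hpM.adj_apply hz)) h'
      rw [← this] at hz ⊢
      exact hG (hf.adj z hz))
    have hFs : T.IsStablePerm T.stableSubtable.graph F := hF.isStablePerm.mono henv.le henv.adj
    have h1 := hne F hFs le_rfl
    have h2 := hne F.symm hFs.inv le_rfl
    exact hadj (hF.stableSubtable_adj_of_lt le_sup_left hp (by omega) (by omega))
  obtain ⟨m, hm, hmsymm, hmu⟩ := hF1.exists_median hmid hp hsymm
  -- Each `m z` is `F z`, `F.symm z`, or a `p z` strictly between them in utility; in the last case
  -- the edge is stable by `stableSubtable_adj_of_lt`.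
  have hmadj : ∀ z, m z ≠ z → T.stableSubtable.graph.Adj z (m z) := by
    intro z hz
    have h0 := hmid z
    have h1 := hmu z
    rcases le_or_gt (T.util z (F z)) (T.util z (p z)) with h | h
    · have h2 : F z = m z :=
        hF1.eq_of_util_eq (fun _ => hGT (hm.adj z hz)) (by omega)
      rw [← h2] at hz ⊢
      exact henv.adj z hz
    rcases le_or_gt (T.util z (p z)) (T.util z (F.symm z)) with h' | h'
    · have h2 : F.symm z = m z :=
        hF1.inv.eq_of_util_eq (fun _ => hGT (hm.adj z hz)) (by omega)
      rw [← h2] at hz ⊢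
      exact henv.symm_adj hz
    · have h2 : p z = m z :=
        hp.eq_of_util_eq (fun _ => hGT (hm.adj z hz)) (by omega)
      rw [← h2]
      exact hF.stableSubtable_adj_of_lt le_sup_left hp h' h
  have hmst : T.IsStablePerm T.stableSubtable.graph m := hm.mono le_sup_left hmadj
  -- the agents who are better off than in every stable matching
  have hX : ∀ x, T.util x (F x) < T.util x (p x) →
      T.util (F x) (p (F x)) < T.util (F x) (F.symm (F x)) := fun x hx => by
    have := hF1.util_symm_lt' hp hx
    rwa [hsymm] at this
  have hY : ∀ y, T.util y (p y) < T.util y (F.symm y) →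
      T.util (p y) (F (p y)) < T.util (p y) (p (p y)) := fun y hy => by
    have := hp.inv.util_symm_lt' hF1.inv (z := y) (by rwa [hsymm])
    rwa [Equiv.symm_symm, Equiv.symm_symm, hsymm] at this
  obtain ⟨x₀, hx₀⟩ : ∃ x, T.util x (F x) < T.util x (p x) := by
    have hMle : ¬ M ≤ T.stableSubtable.graph := fun h =>
      hMS ((hpM.mem_stableMatchings_iff henv.le rfl).2 ((hpM.isStablePerm_iff henv.le).2 ⟨h, hb⟩))
    obtain ⟨a, b, hab, hn⟩ : ∃ a b, M.Adj a b ∧ ¬ T.stableSubtable.graph.Adj a b := by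
      by_contra! h
      exact hMle fun a b hab => h a b hab
    obtain ⟨rfl, hne⟩ := (hpM.2 a b).1 hab
    rcases hout a hne hn with h | h
    · exact ⟨a, h⟩
    · exact ⟨p a, hY a h⟩
  -- By `hX` the agent `F x` falls below its worst stable partner, and by `hY` its `p`-partner is
  -- again above its best. So the whole orbit of `x₀` consists of agents above their best.
  let π : Equiv.Perm A := F.trans p
  have hπ : ∀ n : ℕ,
      T.util ((π ^ n) x₀) (F ((π ^ n) x₀)) < T.util ((π ^ n) x₀) (p ((π ^ n) x₀)) := by
    intro n
    induction n with
    | zero => exact hx₀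
    | succ n ih =>
      rw [pow_succ', Equiv.Perm.mul_apply]
      exact hY _ (hX _ ih)
  obtain ⟨ρ, hx, horbit, hy⟩ := PairSequence.exists_of_perm π x₀ p
  have hnext : ∀ i, F (ρ.x i) = ρ.y (i + 1) := fun i => by
    rw [hy, hx]
    exact (hpp _).symm
  have htop : ∀ i, T.util (ρ.x i) (F (ρ.x i)) < T.util (ρ.x i) (ρ.y i) := fun i => by
    obtain ⟨n, hn⟩ := horbit i
    rw [hy, hn]
    exact hπ n
  refine ⟨ρ, isStitchedRotation_of_forall hF hsymm hmst hmsymm (fun i => (hy i).symm) hnext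
    (fun i => ?_) htop fun i => ?_⟩
  · have h1 : F (ρ.x i) ≠ ρ.x i := fun h => by
      have := hX _ (hy i ▸ htop i)
      rw [h] at this
      have h2 := hmid (ρ.x i)
      rw [h, T.util_self] at h2
      omega
    rw [← hnext]
    refine hm.eq_of_util_eq (fun _ => henv.le (henv.adj _ h1)) ?_
    have h2 := hmid (ρ.x i)
    have h3 : T.util (ρ.x i) (F (ρ.x i)) < T.util (ρ.x i) (p (ρ.x i)) := hy i ▸ htop i
    rw [hmu]
    omega
  · have h1 := hF1.util_symm_lt hp (hy i ▸ htop i)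
    rwa [Equiv.symm_apply_apply, ← hy] at h1

/-- Every stitched rotation is contained in a matching that can be added to the stable
matchings of `T*`. -/
theorem IsStitchedRotation.exists_matching (hT : T.Solvable) {ρ : PairSequence A}
    (hρ : T.IsStitchedRotation ρ) :
    ∃ M ∈ T.matchings, M ∉ T.stableMatchings ∧ M ∉ T.stableSubtable.stableMatchings ∧
      (∀ a b, T.stableSubtable.graph.Adj a b → ¬ T.EdgeBlocks a b M) ∧
      ρ.graph ≤ M ∧ T.InternallyStable ({M} ∪ T.stableSubtable.stableMatchings) := by
  obtain ⟨hanti, hexp, -, hdual⟩ := hρ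
  obtain ⟨p, hp, hsymm⟩ := exists_isStablePerm_of_solvable hT
  have hle : (T.union T.stableSubtable ρ).graph ≤ T.graph := inf_le_left
  have hle' : T.stableSubtable.graph ≤ (T.union T.stableSubtable ρ).graph :=
    le_inf stableSubtable_graph_le le_sup_left
  -- Solvability passes to `T* ∪ ρ`: a stable matching of `T` uses only edges of `T*`.
  have hp' : T.IsStablePerm (T.union T.stableSubtable ρ).graph p :=
    hp.mono hle fun z hz => hle' (stableSubtable_adj_iff.2 ⟨hz, p, hp, hsymm, rfl⟩)
  obtain ⟨m, hm, hmsymm, hmρ⟩ := exists_isStablePerm_apply_eq hle rfl hp' hsymm hexp hdual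
  obtain ⟨M, hM⟩ := exists_graph_isPartnerPerm hmsymm
  obtain ⟨hMle, hMb⟩ := (hM.isStablePerm_iff hle).1 hm
  have hMT : M ∈ T.matchings := ⟨hMle.trans hle, fun a b c => hM.eq_of_adj⟩
  have hMρ : ∀ i, M.Adj (ρ.x i) (ρ.y i) := fun i =>
    (hM.2 _ _).2 ⟨hmρ i, (hanti i).1.ne'⟩
  have hMout : ¬ M ≤ T.stableSubtable.graph := fun h => (hanti 0).2.1 (h (hMρ 0))
  have hself : ∀ a b (N : SimpleGraph A), N.Adj a b → ¬ T.EdgeBlocks a b N :=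
    fun a b N hab h => T.prefers_irrefl a b h.1 (h.2.1 b hab)
  have hunb : ∀ N ∈ T.stableSubtable.stableMatchings, ∀ a b, T.stableSubtable.graph.Adj a b →
      ¬ T.EdgeBlocks a b N := fun N hN a b hab h => hN.2 a b ⟨hab, h.2⟩
  -- Every stable matching of `T*` matches `y`, since all of them match the same agents. So `y` gets
  -- at least its last agent in `T*`, whom it prefers to `x`.
  have hlast : ∀ N ∈ T.stableSubtable.stableMatchings, ∀ x y, T.graph.Adj x y →
      (∃ l, T.stableSubtable.IsLast y l ∧ T.prefers y l x) → ¬ T.PrefersToPartner y x N := by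
    rintro N hN x y hxy ⟨l, hl, hlx⟩ h
    obtain ⟨q, hq⟩ := exists_isPartnerPerm hN.1.2
    have hqs := (hq.mem_stableMatchings_iff (T := T) stableSubtable_graph_le rfl).1 hN
    obtain ⟨hne, q', hq', hsymm', rfl⟩ := stableSubtable_adj_iff.1 hl.1
    have hq's : T.IsStablePerm T.stableSubtable.graph q' :=
      hq'.mono stableSubtable_graph_le fun z hz =>
        stableSubtable_adj_iff.2 ⟨hz, q', hq', hsymm', rfl⟩
    have hy : q y ≠ y := hqs.ne_self_of_ne_self hq's hne
    have hNy := hq.adj_apply hy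
    have h1 := (hq.prefersToPartner_iff (hN.1.1.trans stableSubtable_graph_le) hxy.symm).1 h
    have h2 := hl.util_le (T := T) stableSubtable_graph_le (fun _ _ _ _ _ h => h) (hN.1.1 hNy)
    have h3 := T.util_lt_of_prefers (stableSubtable_graph_le hl.1) hxy.symm hlx
    omega
  refine ⟨M, hMT, fun h => hMout fun a b hab => ⟨hMT.1 hab, M, h, hab⟩, fun h => hMout h.1.1,
    fun a b hab => hMb a b (hle' hab), fun a b hab => ?_, ?_, ?_⟩
  · rcases (ρ.graph_adj.1 hab).2 with ⟨i, rfl, rfl⟩ | ⟨i, rfl, rfl⟩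
    · exact hMρ i
    · exact (hMρ i).symm
  · rintro N (rfl | hN)
    · exact hMT
    · exact ⟨hN.1.1.trans stableSubtable_graph_le, hN.1.2⟩
  · rintro N₀ (rfl | hN₀) N₁ (rfl | hN₁) ⟨a, b, hab, hblock⟩
    · exact hself a b _ hab hblock
    · rcases (hMle hab).2 with h | h
      · exact hunb N₁ hN₁ a b h hblock
      · have key : ∀ i, ¬ T.EdgeBlocks (ρ.x i) (ρ.y i) N₁ := by
          intro i hi
          rcases (hanti i).2.2 with h' | h'
          · exact hlast N₁ hN₁ _ _ hi.1 h'.1.2 hi.2.2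
          · exact hlast N₁ hN₁ _ _ hi.1.symm h'.1.2 hi.2.1
        rcases (ρ.graph_adj.1 h).2 with ⟨i, rfl, rfl⟩ | ⟨i, rfl, rfl⟩
        · exact key i hblock
        · exact key i ⟨hblock.1.symm, hblock.2.2, hblock.2.1⟩
    · exact hMb a b (hle' (hN₀.1.1 hab)) hblock
    · exact hunb N₁ hN₁ a b (hN₀.1.1 hab) hblock

end RoommateInstance

theorem mainTheorem5 {A : Type*} [Finite A] (T : RoommateInstance A) (hT : T.Solvable) :
    -- an unblocked matching outside `S(T*)` exists iff a stitched rotation exists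
    ((∃ M ∈ T.matchings, M ∉ T.stableSubtable.stableMatchings ∧
        ∀ a b, T.stableSubtable.graph.Adj a b → ¬ T.EdgeBlocks a b M) ↔
      ∃ ρ : PairSequence A, T.IsStitchedRotation ρ) ∧
    -- every stitched rotation lies in such a matching
    (∀ ρ : PairSequence A, T.IsStitchedRotation ρ →
      ∃ M ∈ T.matchings, M ∉ T.stableMatchings ∧ M ∉ T.stableSubtable.stableMatchings ∧
        (∀ a b, T.stableSubtable.graph.Adj a b → ¬ T.EdgeBlocks a b M) ∧
        ρ.graph ≤ M ∧
        T.InternallyStable ({M} ∪ T.stableSubtable.stableMatchings)) ∧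
    -- the criterion for internal closedness
    (T.InternallyClosed T.stableSubtable.stableMatchings ↔
      ¬ ∃ ρ : PairSequence A, T.IsStitchedRotation ρ) := by
  have hcriterion : (∃ M ∈ T.matchings, M ∉ T.stableSubtable.stableMatchings ∧
      ∀ a b, T.stableSubtable.graph.Adj a b → ¬ T.EdgeBlocks a b M) ↔
      ∃ ρ : PairSequence A, T.IsStitchedRotation ρ := by
    constructor
    · rintro ⟨M, hM, hMS, hb⟩
      exact RoommateInstance.exists_isStitchedRotation hT hM hMS hb
    · rintro ⟨ρ, hρ⟩
      obtain ⟨M, hM, -, hMS, hb, -⟩ := hρ.exists_matching hT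
      exact ⟨M, hM, hMS, hb⟩
  refine ⟨hcriterion, fun ρ hρ => hρ.exists_matching hT, fun h => ?_, fun h => ?_⟩
  · rintro ⟨ρ, hρ⟩
    obtain ⟨M, hM, -, hMS, -, -, hint⟩ := hρ.exists_matching hT
    refine hMS ?_
    rw [← h.2]
    exact ⟨hM, hint⟩
  · refine ⟨RoommateInstance.internallyStable_stableSubtable, Set.Subset.antisymm ?_ ?_⟩
    · rintro M ⟨hM, hint⟩
      by_contra hMS
      refine h (hcriterion.1 ⟨M, hM, hMS, ?_⟩)
      -- An edge of `T*` lies in some stable matching `N` of `T`, so if it blocked `M`, then `N`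
      -- would block `M`.
      rintro a b ⟨-, N, hN, hab⟩ hblock
      exact hint.2 N (Or.inr (RoommateInstance.stableMatchings_subset_stableSubtable hN)) M
        (Or.inl rfl) ⟨a, b, hab, hblock⟩
    · intro M hM
      have hint := RoommateInstance.internallyStable_stableSubtable (T := T)
      refine ⟨hint.1 hM, ?_⟩
      rwa [Set.singleton_union, Set.insert_eq_of_mem hM]
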